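/- There is a deterministic algorithm which, given a finite simple undirected graph $G$ without an induced path on four vertices (a $P_4$-free graph) and a weight function $w:E(G)\to\mathbb{Q}$, determines a maximum weight acyclic matching of $G$ in polynomial time. Here a matching $M$ (a set of pairwise disjoint edges) of $G$ is acyclic if the subgraph of $G$ induced by the set of vertices incident with an edge in $M$ is a forest, and an acyclic matching $M$ has maximum weight if $\sum_{e\in M} w(e)\ge \sum_{e\in M'} w(e)$ for every acyclic matching $M'$ of $G$. Polynomial time means that a random access machine with integer registers and arrays and operations $+,-,\times$, with logarithmic costs (every operation is charged the binary length of the integers and addresses involved), outputs such a matching within a time that is bounded by a fixed polynomial in the binary encoding length of $(G,w)$, where $G$ is given by its adjacency matrix and each weight by its numerator and denominator. -/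

import Mathlib

/-! ### A random access machine with logarithmic costs

Programs are structured (assignment, composition, branching, loops). They work on finitely many
integer registers and finitely many integer arrays, both named by natural numbers. Every operation
is charged the binary length of the integers involved, addresses included. -/

namespace RAM

/-- Length of the binary representation of an integer, including a sign bit. -/
def bitLength (z : ℤ) : ℕ := Nat.size z.natAbs + 1

/-- The memory of the machine: integer registers, and integer arrays indexed by addresses. -/
@[ext]
structure State where
  reg : ℕ → ℤ
  arr : ℕ → ℤ → ℤ

/-- Arithmetic expressions. `read a e` is the content of array `a` at address `e`. -/
inductive Expr where
  | const (z : ℤ)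
  | reg (r : ℕ)
  | read (a : ℕ) (e : Expr)
  | add (e f : Expr)
  | sub (e f : Expr)
  | mul (e f : Expr)

/-- The value of an expression. -/
def Expr.val (s : State) : Expr → ℤ
  | const z => z
  | reg r => s.reg r
  | read a e => s.arr a (e.val s)
  | add e f => e.val s + f.val s
  | sub e f => e.val s - f.val s
  | mul e f => e.val s * f.val s

/-- The cost of evaluating an expression: every operation costs one plus the length of its result
(the lengths of its operands are charged where these are evaluated). -/
def Expr.cost (s : State) : Expr → ℕ
  | const z => 1 + bitLength z
  | reg r => 1 + bitLength (s.reg r)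
  | read a e => e.cost s + (1 + bitLength (s.arr a (e.val s)))
  | add e f => e.cost s + f.cost s + (1 + bitLength (e.val s + f.val s))
  | sub e f => e.cost s + f.cost s + (1 + bitLength (e.val s - f.val s))
  | mul e f => e.cost s + f.cost s + (1 + bitLength (e.val s * f.val s))

/-- Programs. The branching `cond e p q` runs `p` if the value of `e` is positive and `q` otherwise;
`loop e p` repeats `p` as long as the value of `e` is positive. -/
inductive Program where
  | skip
  | assign (r : ℕ) (e : Expr)
  | store (a : ℕ) (i e : Expr)
  | seq (p q : Program)
  | cond (e : Expr) (p q : Program)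
  | loop (e : Expr) (p : Program)

/-- Setting a register. -/
def State.setReg (s : State) (r : ℕ) (z : ℤ) : State :=
  { s with reg := Function.update s.reg r z }

/-- Setting an array cell. -/
def State.setArr (s : State) (a : ℕ) (i z : ℤ) : State :=
  { s with arr := Function.update s.arr a (Function.update (s.arr a) i z) }

/-- `Runs p s s' t`: started in state `s`, the program `p` halts in state `s'` after time `t`. -/
inductive Runs : Program → State → State → ℕ → Prop where
  | skip (s : State) : Runs .skip s s 1
  | assign (s : State) (r : ℕ) (e : Expr) :
      Runs (.assign r e) s (s.setReg r (e.val s)) (1 + e.cost s)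
  | store (s : State) (a : ℕ) (i e : Expr) :
      Runs (.store a i e) s (s.setArr a (i.val s) (e.val s)) (1 + i.cost s + e.cost s)
  | seq {p q : Program} {s s' s'' : State} {t t' : ℕ} :
      Runs p s s' t → Runs q s' s'' t' → Runs (.seq p q) s s'' (t + t')
  | condPos {e : Expr} {p q : Program} {s s' : State} {t : ℕ} :
      0 < e.val s → Runs p s s' t → Runs (.cond e p q) s s' (1 + e.cost s + t)
  | condNonpos {e : Expr} {p q : Program} {s s' : State} {t : ℕ} :
      e.val s ≤ 0 → Runs q s s' t → Runs (.cond e p q) s s' (1 + e.cost s + t)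
  | loopPos {e : Expr} {p : Program} {s s' s'' : State} {t t' : ℕ} :
      0 < e.val s → Runs p s s' t → Runs (.loop e p) s' s'' t' →
        Runs (.loop e p) s s'' (1 + e.cost s + t + t')
  | loopNonpos {e : Expr} {p : Program} {s : State} :
      e.val s ≤ 0 → Runs (.loop e p) s s (1 + e.cost s)

/-- The initial state for an input word: the word is in array `0`, starting at address `0`,
its number of entries is in register `0`, and everything else is `0`. -/
def State.init (x : List ℤ) : State where
  reg := fun r => if r = 0 then x.length else 0
  arr := fun a i => if a = 0 ∧ 0 ≤ i then x.getD i.toNat 0 else 0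

/-- The state `s` presents the output word `y`: the word is in array `1`, starting at
address `0`, and its number of entries is in register `0`. -/
def State.Outputs (s : State) (y : List ℤ) : Prop :=
  s.reg 0 = y.length ∧ ∀ (k : ℕ) (hk : k < y.length), s.arr 1 k = y[k]

/-- The encoding length of a word, in bits. -/
def wordLength (x : List ℤ) : ℕ := (x.map bitLength).sum

/-- Polynomial time solvability of a search problem: a single program, given (the encoding of) any
admissible instance `a`, halts within a time that is polynomial in the encoding length of `a`, and
outputs (the encoding of) a solution of `a`. -/
def SolvableInPolyTime {α : Type*} {β : α → Type*} (admissible : α → Prop)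
    (solution : (a : α) → β a → Prop) (encodeIn : α → List ℤ)
    (encodeOut : (a : α) → β a → List ℤ) : Prop :=
  ∃ (p : Program) (T : Polynomial ℕ), ∀ a : α, admissible a →
    ∃ (s : State) (t : ℕ), Runs p (State.init (encodeIn a)) s t ∧
      t ≤ T.eval (wordLength (encodeIn a)) ∧
      ∃ b : β a, solution a b ∧ s.Outputs (encodeOut a b)

end RAM

/-! ### Acyclic matchings -/

namespace SimpleGraph

variable {V : Type*}

/-- A graph is `P₄`-free if it has no induced subgraph that is a path on four vertices. -/
def IsP4Free (G : SimpleGraph V) : Prop := ¬ (pathGraph 4).IsIndContained G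

/-- A finite set of pairwise disjoint edges of `G`. -/
def IsEdgeMatching (G : SimpleGraph V) (M : Finset (Sym2 V)) : Prop :=
  (∀ e ∈ M, e ∈ G.edgeSet) ∧ ∀ e ∈ M, ∀ f ∈ M, ∀ v : V, v ∈ e → v ∈ f → e = f

/-- The set of vertices that are incident with an edge in `M`. -/
def coveredVertices (M : Finset (Sym2 V)) : Set V := {v | ∃ e ∈ M, v ∈ e}

/-- A matching is acyclic if the vertices that it covers induce a forest. -/
def IsAcyclicMatching (G : SimpleGraph V) (M : Finset (Sym2 V)) : Prop :=
  G.IsEdgeMatching M ∧ (G.induce (coveredVertices M)).IsAcyclic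

/-- An acyclic matching of maximum weight. -/
def IsMaxWeightAcyclicMatching (G : SimpleGraph V) (w : Sym2 V → ℚ) (M : Finset (Sym2 V)) : Prop :=
  G.IsAcyclicMatching M ∧
    ∀ M' : Finset (Sym2 V), G.IsAcyclicMatching M' → ∑ e ∈ M', w e ≤ ∑ e ∈ M, w e

end SimpleGraph

/-- A finite graph with rational edge weights. Only the values of `weight` on the edges of the
graph matter. -/
structure EdgeWeightedGraph where
  order : ℕ
  graph : SimpleGraph (Fin order)
  weight : Sym2 (Fin order) → ℚ

/-- The entries of an `n × n` matrix, row by row. -/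
def matrixWord {n : ℕ} (A : Fin n → Fin n → ℤ) : List ℤ :=
  List.ofFn fun k : Fin (n * n) => A k.divNat k.modNat

open Classical in
/-- The encoding of an edge-weighted graph: its order, its adjacency matrix, and the matrices of
the numerators and of the denominators of its edge weights (non-edges carry `0 = 0 / 1`). -/
noncomputable def EdgeWeightedGraph.encode (I : EdgeWeightedGraph) : List ℤ :=
  (I.order : ℤ) ::
    (matrixWord (fun u v => if I.graph.Adj u v then 1 else 0) ++
      matrixWord (fun u v => if I.graph.Adj u v then (I.weight s(u, v)).num else 0) ++
      matrixWord (fun u v => if I.graph.Adj u v then ((I.weight s(u, v)).den : ℤ) else 1))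

/-- The encoding of a set of edges by its characteristic matrix. -/
def edgeSetWord {n : ℕ} (M : Finset (Sym2 (Fin n))) : List ℤ :=
  matrixWord fun u v => if s(u, v) ∈ M then 1 else 0

/-! In a `P₄`-free graph a matching is acyclic if and only if it is induced, that is, no edge of the
graph joins two different matching edges. If `ab` and `cd` are matching edges and `bc` is an edge,
then the path `abcd` has a chord or closes up, so the covered vertices contain a triangle or a
four-cycle (`IsAcyclicMatching.not_adj`). Conversely, the covered vertices of an induced matching
induce disjoint edges (`IsEdgeMatching.isAcyclicMatching`). Edges of nonpositive weight can be
dropped. Hence the task is a maximum weight independent set problem for the edges of positive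
weight, where two edges conflict if an end of one is adjacent to an end of the other. Edges with a
common vertex conflict, and so do the two orientations of one edge, so it is harmless to work with
ordered pairs of vertices.

By Seinsche's theorem (`NoP4.splits`) the graph is a cograph, and the conflict relation inherits
this (`IsCographOn.pairs`). A cograph with at least two elements contains twins
(`IsCographOn.exists_twins`). Of two conflicting twins the lighter one is dropped; two
non-conflicting twins are merged and their weights added. `Represents` is the invariant of this
elimination: each remaining element stands for an independent set of original pairs, and some
independent set of remaining elements is as good as any given independent set. When at most one
element remains, the pairs it owns form an optimal solution (`Represents.optimal`). Weights become
integers by multiplication with the product of all denominators.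

For the running time, every loop of the program runs `n ^ k` times with a fixed `k`, and every
product has an input entry as a factor. A single operation thus lengthens integers by at most the
input length, so lengths and time are bounded by polynomials computed by recursion on the program
(`Cmd.runs_compile`). -/

/-! ### Programs with bounded loops

Programs whose loops run `n ^ k` times, where `n` is the first entry of the input, and which
multiply by input entries only. Such programs run in polynomial time. -/

namespace RAM

/-- The input, as the content of array `0`: its first entry is `n`, and `N` bounds both `n` and the
binary lengths of all entries. -/
structure IsInput (inp : ℤ → ℤ) (n N : ℕ) : Prop where
  order : inp 0 = n
  order_le : n ≤ N
  bitLength_le : ∀ i, bitLength (inp i) ≤ N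

/-! ### Binary lengths under arithmetic, and the cost of expressions. -/

lemma bitLength_pos (z : ℤ) : 1 ≤ bitLength z := by simp [bitLength]

lemma IsInput.one_le {inp : ℤ → ℤ} {n N : ℕ} (h : IsInput inp n N) : 1 ≤ N :=
  (bitLength_pos _).trans (h.bitLength_le 0)

lemma bitLength_le_iff {z : ℤ} {k : ℕ} : bitLength z ≤ k + 1 ↔ z.natAbs < 2 ^ k := by
  simp [bitLength, Nat.size_le]

lemma natAbs_lt_of_bitLength_le {x : ℤ} {a : ℕ} (h : bitLength x ≤ a) :
    x.natAbs < 2 ^ (a - 1) := by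
  have := bitLength_pos x
  obtain ⟨a, rfl⟩ : ∃ k, a = k + 1 := ⟨a - 1, by omega⟩
  exact bitLength_le_iff.1 h

lemma bitLength_add_le {x y : ℤ} {a : ℕ} (hx : bitLength x ≤ a) (hy : bitLength y ≤ a) :
    bitLength (x + y) ≤ a + 1 := by
  have h1 := natAbs_lt_of_bitLength_le hx
  have h2 := natAbs_lt_of_bitLength_le hy
  have h3 := bitLength_pos x
  obtain ⟨a, rfl⟩ : ∃ k, a = k + 1 := ⟨a - 1, by omega⟩
  refine bitLength_le_iff.2 ?_
  simp only [Nat.add_sub_cancel] at h1 h2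
  rw [pow_succ]
  omega

lemma bitLength_neg (x : ℤ) : bitLength (-x) = bitLength x := by simp [bitLength]

lemma bitLength_sub_le {x y : ℤ} {a : ℕ} (hx : bitLength x ≤ a) (hy : bitLength y ≤ a) :
    bitLength (x - y) ≤ a + 1 := by
  rw [sub_eq_add_neg]
  exact bitLength_add_le hx (by rwa [bitLength_neg])

lemma bitLength_mul_le {x y : ℤ} {a b : ℕ} (hx : bitLength x ≤ a) (hy : bitLength y ≤ b) :
    bitLength (x * y) ≤ a + b := by
  have h1 := natAbs_lt_of_bitLength_le hx
  have h2 := natAbs_lt_of_bitLength_le hy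
  have h3 := bitLength_pos x
  have h4 := bitLength_pos y
  obtain ⟨a, rfl⟩ : ∃ k, a = k + 1 := ⟨a - 1, by omega⟩
  obtain ⟨b, rfl⟩ : ∃ k, b = k + 1 := ⟨b - 1, by omega⟩
  refine le_trans (bitLength_le_iff (k := a + b).2 ?_) (by omega)
  rw [Int.natAbs_mul, pow_add]
  exact Nat.mul_lt_mul'' h1 h2

lemma bitLength_natCast_le (k : ℕ) : bitLength (k : ℤ) ≤ k + 1 := by
  rw [bitLength_le_iff]
  simpa using Nat.lt_two_pow_self

/-- All multiplications have an input entry as their second factor. -/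
def Expr.tame : Expr → Bool
  | const _ => true
  | reg _ => true
  | read _ e => e.tame
  | add e f => e.tame && f.tame
  | sub e f => e.tame && f.tame
  | mul e (read 0 f) => e.tame && f.tame
  | mul _ _ => false

/-- The number of operations, where constants count with their lengths. -/
def Expr.size : Expr → ℕ
  | const z => bitLength z
  | reg _ => 1
  | read _ e => e.size + 1
  | add e f => e.size + f.size + 1
  | sub e f => e.size + f.size + 1
  | mul e f => e.size + f.size + 1

/-- All integers in the memory have length at most `L`. -/
structure State.Bounded (s : State) (L : ℕ) : Prop where
  reg : ∀ r, bitLength (s.reg r) ≤ L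
  arr : ∀ a i, bitLength (s.arr a i) ≤ L

lemma State.Bounded.mono {s : State} {L L' : ℕ} (h : s.Bounded L) (hL : L ≤ L') :
    s.Bounded L' :=
  ⟨fun r => (h.reg r).trans hL, fun a i => (h.arr a i).trans hL⟩

lemma State.Bounded.setReg {s : State} {L : ℕ} (h : s.Bounded L) {r : ℕ} {z : ℤ}
    (hz : bitLength z ≤ L) : (s.setReg r z).Bounded L := by
  refine ⟨fun r' => ?_, h.arr⟩
  by_cases hr : r' = r
  · subst hr; simpa [State.setReg] using hz
  · simpa [State.setReg, hr] using h.reg r'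

lemma State.Bounded.setArr {s : State} {L : ℕ} (h : s.Bounded L) {a : ℕ} {i z : ℤ}
    (hz : bitLength z ≤ L) : (s.setArr a i z).Bounded L := by
  refine ⟨h.reg, fun a' i' => ?_⟩
  by_cases ha : a' = a
  · subst ha
    by_cases hi : i' = i
    · subst hi; simpa [State.setArr] using hz
    · simpa [State.setArr, hi] using h.arr a' i'
  · simpa [State.setArr, ha] using h.arr a' i'

/-- Each operation adds at most `N` to the length: sums and differences add one bit, and a tame
product has an input entry of length at most `N` as its second factor. Unrestricted products could
double the length in every iteration of a loop. -/
lemma Expr.bitLength_val_le {inp : ℤ → ℤ} {n N : ℕ} (hin : IsInput inp n N) {s : State} {L : ℕ}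
    (h0 : s.arr 0 = inp) (h : s.Bounded L) (e : Expr) (he : e.tame = true) :
    bitLength (e.val s) ≤ L + e.size * N := by
  have hN := hin.one_le
  induction e using Expr.tame.induct with
  | case1 z =>
    simp only [Expr.val, Expr.size]
    nlinarith [bitLength_pos z]
  | case2 r =>
    have := h.reg r
    simp only [Expr.val]; omega
  | case3 a e ih =>
    have := h.arr a (e.val s)
    simp only [Expr.val]; omega
  | case4 e f ihe ihf =>
    simp only [Expr.tame, Bool.and_eq_true] at he
    have := bitLength_add_le (a := L + (e.size + f.size) * N)
      ((ihe he.1).trans (by nlinarith)) ((ihf he.2).trans (by nlinarith))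
    simp only [Expr.val, Expr.size]
    nlinarith
  | case5 e f ihe ihf =>
    simp only [Expr.tame, Bool.and_eq_true] at he
    have := bitLength_sub_le (a := L + (e.size + f.size) * N)
      ((ihe he.1).trans (by nlinarith)) ((ihf he.2).trans (by nlinarith))
    simp only [Expr.val, Expr.size]
    nlinarith
  | case6 e f ihe ihf =>
    simp only [Expr.tame, Bool.and_eq_true] at he
    have := bitLength_mul_le (ihe he.1) (hin.bitLength_le (f.val s))
    simp only [Expr.val, Expr.size, h0]
    nlinarith
  | case7 e f hf =>
    unfold Expr.tame at he
    split at he <;> simp_all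

/-- Every operation costs one plus the length of its result, and each intermediate result obeys the
bound of `Expr.bitLength_val_le`. -/
lemma Expr.cost_le {inp : ℤ → ℤ} {n N : ℕ} (hin : IsInput inp n N) {s : State} {L : ℕ}
    (h0 : s.arr 0 = inp) (h : s.Bounded L) (e : Expr) (he : e.tame = true) :
    e.cost s ≤ e.size * (1 + L + e.size * N) := by
  have hN := hin.one_le
  have hL : 1 ≤ L := (bitLength_pos _).trans (h.reg 0)
  induction e using Expr.tame.induct with
  | case1 z =>
    simp only [Expr.cost, Expr.size]
    have hz := bitLength_pos z
    have := Nat.mul_le_mul_left (bitLength z) (show 2 ≤ 1 + L + bitLength z * N by omega)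
    omega
  | case2 r =>
    have := h.reg r
    simp only [Expr.cost, Expr.size]; omega
  | case3 a e ih =>
    have h1 := h.arr a (e.val s)
    have h2 := ih he
    simp only [Expr.cost, Expr.size]
    nlinarith
  | case4 e f ihe ihf =>
    have h3 := Expr.bitLength_val_le hin h0 h _ he
    simp only [Expr.tame, Bool.and_eq_true] at he
    have h1 := ihe he.1
    have h2 := ihf he.2
    simp only [Expr.cost, Expr.size, Expr.val] at h3 ⊢
    have h1' : e.cost s ≤ e.size * (1 + L + (e.size + f.size + 1) * N) :=
      h1.trans (by gcongr; omega)
    have h2' : f.cost s ≤ f.size * (1 + L + (e.size + f.size + 1) * N) :=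
      h2.trans (by gcongr; omega)
    linarith
  | case5 e f ihe ihf =>
    have h3 := Expr.bitLength_val_le hin h0 h _ he
    simp only [Expr.tame, Bool.and_eq_true] at he
    have h1 := ihe he.1
    have h2 := ihf he.2
    simp only [Expr.cost, Expr.size, Expr.val] at h3 ⊢
    have h1' : e.cost s ≤ e.size * (1 + L + (e.size + f.size + 1) * N) :=
      h1.trans (by gcongr; omega)
    have h2' : f.cost s ≤ f.size * (1 + L + (e.size + f.size + 1) * N) :=
      h2.trans (by gcongr; omega)
    linarith
  | case6 e f ihe ihf =>
    have h3 := Expr.bitLength_val_le hin h0 h _ he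
    simp only [Expr.tame, Bool.and_eq_true] at he
    have h1 := ihe he.1
    have h2 := ihf he.2
    have h4 := h.arr 0 (f.val s)
    simp only [Expr.cost, Expr.size, Expr.val] at h3 ⊢
    have h1' : e.cost s ≤ e.size * (1 + L + (e.size + (f.size + 1) + 1) * N) :=
      h1.trans (by gcongr; omega)
    have h2' : f.cost s ≤ f.size * (1 + L + (e.size + (f.size + 1) + 1) * N) :=
      h2.trans (by gcongr; omega)
    nlinarith
  | case7 e f hf =>
    unfold Expr.tame at he
    split at he <;> simp_all

/-- Programs with bounded loops: `loop r k p` runs `p` for all values of register `r` from `0` to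
`n ^ k - 1`. -/
inductive Cmd where
  | skip
  | assign (r : ℕ) (e : Expr)
  | store (a : ℕ) (i e : Expr)
  | seq (p q : Cmd)
  | cond (e : Expr) (p q : Cmd)
  | loop (r k : ℕ) (p : Cmd)

/-- The first entry of the input. -/
def Expr.order : Expr := .read 0 (.const 0)

/-- The `k`-th power of the first entry of the input. -/
def Expr.orderPow : ℕ → Expr
  | 0 => .const 1
  | k + 1 => .mul (orderPow k) .order

/-! ### Semantics of programs with bounded loops. -/

namespace Cmd

/-- The translation into a program of the machine. -/
def compile : Cmd → Program
  | skip => .skip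
  | assign r e => .assign r e
  | store a i e => .store a i e
  | seq p q => .seq p.compile q.compile
  | cond e p q => .cond e p.compile q.compile
  | loop r k p => .seq (.assign r (.const 0))
      (.loop (.sub (.orderPow k) (.reg r))
        (.seq p.compile (.assign r (.add (.reg r) (.const 1)))))

/-- The memory after a run. -/
def run (n : ℕ) : Cmd → State → State
  | skip, s => s
  | assign r e, s => s.setReg r (e.val s)
  | store a i e, s => s.setArr a (i.val s) (e.val s)
  | seq p q, s => q.run n (p.run n s)
  | cond e p q, s => if 0 < e.val s then p.run n s else q.run n s
  | loop r k p, s =>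
      (fun s => (p.run n s).setReg r ((p.run n s).reg r + 1))^[n ^ k] (s.setReg r 0)

/-- The registers that a program writes. -/
def writes : Cmd → List ℕ
  | skip => []
  | assign r _ => [r]
  | store _ _ _ => []
  | seq p q => p.writes ++ q.writes
  | cond _ p q => p.writes ++ q.writes
  | loop r _ p => r :: p.writes

/-- The arrays that a program writes. -/
def stores : Cmd → List ℕ
  | skip => []
  | assign _ _ => []
  | store a _ _ => [a]
  | seq p q => p.stores ++ q.stores
  | cond _ p q => p.stores ++ q.stores
  | loop _ _ p => p.stores

/-- All expressions are tame, and loops do not write their counters. -/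
def tame : Cmd → Bool
  | skip => true
  | assign _ e => e.tame
  | store _ i e => i.tame && e.tame
  | seq p q => p.tame && q.tame
  | cond e p q => e.tame && p.tame && q.tame
  | loop r _ p => p.tame && !(p.writes.contains r)

lemma run_reg (n : ℕ) {r : ℕ} (p : Cmd) (s : State) (h : r ∉ p.writes) :
    (p.run n s).reg r = s.reg r := by
  induction p generalizing s with
  | skip => rfl
  | assign r' e =>
    simp only [writes, List.mem_singleton] at h
    simp [run, State.setReg, h]
  | store a i e => rfl
  | seq p q ihp ihq =>
    simp only [writes, List.mem_append, not_or] at h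
    simp [run, ihp _ h.1, ihq _ h.2]
  | cond e p q ihp ihq =>
    simp only [writes, List.mem_append, not_or] at h
    simp only [run]
    split_ifs
    exacts [ihp _ h.1, ihq _ h.2]
  | loop r' k p ih =>
    simp only [writes, List.mem_cons, not_or] at h
    simp only [run]
    have : ∀ j (s : State), ((fun s => (p.run n s).setReg r' ((p.run n s).reg r' + 1))^[j] s).reg r
        = s.reg r := by
      intro j
      induction j with
      | zero => intro s; rfl
      | succ j ihj =>
        intro s
        rw [Function.iterate_succ_apply, ihj]
        simp [State.setReg, h.1, ih _ h.2]
    rw [this]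
    simp [State.setReg, h.1]

lemma run_arr (n : ℕ) {a : ℕ} (p : Cmd) (s : State) (h : a ∉ p.stores) :
    (p.run n s).arr a = s.arr a := by
  induction p generalizing s with
  | skip => rfl
  | assign r' e => rfl
  | store a i e =>
    simp only [stores, List.mem_singleton] at h
    simp [run, State.setArr, h]
  | seq p q ihp ihq =>
    simp only [stores, List.mem_append, not_or] at h
    simp [run, ihp _ h.1, ihq _ h.2]
  | cond e p q ihp ihq =>
    simp only [stores, List.mem_append, not_or] at h
    simp only [run]
    split_ifs
    exacts [ihp _ h.1, ihq _ h.2]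
  | loop r' k p ih =>
    simp only [stores] at h
    simp only [run]
    have : ∀ j (s : State), ((fun s => (p.run n s).setReg r' ((p.run n s).reg r' + 1))^[j] s).arr a
        = s.arr a := by
      intro j
      induction j with
      | zero => intro s; rfl
      | succ j ihj =>
        intro s
        rw [Function.iterate_succ_apply, ihj]
        simp [State.setReg, ih _ h]
    rw [this]
    simp [State.setReg]

/-- The rule for loops. -/
lemma run_loop {n r k : ℕ} {p : Cmd} (Inv : ℕ → State → Prop) {s : State}
    (hr : r ∉ p.writes) (h0 : Inv 0 (s.setReg r 0))
    (hstep : ∀ j < n ^ k, ∀ s : State, s.reg r = j → Inv j s →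
      Inv (j + 1) ((p.run n s).setReg r ((j : ℤ) + 1))) :
    Inv (n ^ k) ((loop r k p).run n s) := by
  have : ∀ j ≤ n ^ k,
      ((fun s => (p.run n s).setReg r ((p.run n s).reg r + 1))^[j] (s.setReg r 0)).reg r = j ∧
      Inv j ((fun s => (p.run n s).setReg r ((p.run n s).reg r + 1))^[j] (s.setReg r 0)) := by
    intro j
    induction j with
    | zero => exact fun _ => ⟨by simp [State.setReg], h0⟩
    | succ j ih =>
      intro hj
      obtain ⟨h1, h2⟩ := ih (by omega)
      have h3 := hstep j (by omega) _ h1 h2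
      rw [Function.iterate_succ_apply']
      generalize (fun s => (p.run n s).setReg r ((p.run n s).reg r + 1))^[j] (s.setReg r 0) = s'
        at h1 h3 ⊢
      rw [run_reg n p _ hr, h1]
      exact ⟨by simp [State.setReg], h3⟩
  exact (this _ le_rfl).2

/-! ### Polynomial bounds for lengths and time. -/

open Polynomial

/-- A bound for the growth of the lengths of the integers in the memory. -/
noncomputable def growth : Cmd → ℕ[X]
  | skip => 0
  | assign _ e => (e.size : ℕ[X]) * X
  | store _ _ e => (e.size : ℕ[X]) * X
  | seq p q => p.growth + q.growth
  | cond _ p q => p.growth + q.growth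
  -- The `4` is the size of the expression that increments the counter: one for the register, two
  -- for the length of the constant `1`, and one for the addition.
  | loop _ k p => X + X ^ k * (p.growth + 4 * X)

/-- A bound for the cost of an expression. -/
noncomputable def exprTime (L : ℕ[X]) (e : Expr) : ℕ[X] :=
  (e.size : ℕ[X]) * (1 + L + (e.size : ℕ[X]) * X)

/-- A bound for the time, if initially all integers in the memory have length at most `L`. -/
noncomputable def time : ℕ[X] → Cmd → ℕ[X]
  | _, skip => 1
  | L, assign _ e => 1 + exprTime L e
  | L, store _ i e => 1 + exprTime L i + exprTime L e
  | L, seq p q => time L p + time (L + p.growth) q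
  | L, cond e p q => 1 + exprTime L e + time L p + time L q
  | L, loop r k p =>
      1 + exprTime L (.const 0) +
      -- The test is evaluated once more than the body. All iterations share the length bound that
      -- is valid for the whole loop.
      ((X ^ k + 1) * (1 + exprTime (L + (loop r k p).growth) (.sub (.orderPow k) (.reg r)) +
        time (L + (loop r k p).growth) p +
        (1 + exprTime (L + (loop r k p).growth + p.growth) (.add (.reg r) (.const 1)))))

variable {inp : ℤ → ℤ} {n N : ℕ}

/-- An iteration lengthens integers by at most the growth of the body plus that of the increment, a
bound independent of the current lengths, so growth over the loop is linear in the number of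
iterations. All `j ≤ n ^ k` are included because the time analysis needs every intermediate state.
-/
lemma iterate_bounded (hin : IsInput inp n N) {r k : ℕ} {p : Cmd} (hr : r ∉ p.writes)
    (h0 : 0 ∉ p.stores)
    (hp : ∀ {s : State} {L : ℕ}, s.arr 0 = inp → s.Bounded L →
      (p.run n s).Bounded (L + p.growth.eval N))
    {s : State} {L : ℕ} (hs0 : s.arr 0 = inp) (hs : s.Bounded L) (j : ℕ) (hj : j ≤ n ^ k) :
    let s' := (fun s => (p.run n s).setReg r ((p.run n s).reg r + 1))^[j] (s.setReg r 0)
    s'.reg r = j ∧ s'.arr 0 = inp ∧ s'.Bounded (L + (loop r k p).growth.eval N) := by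
  have hL : bitLength 0 ≤ L := (bitLength_pos _).trans (hs.reg 0)
  have hb : ∀ j : ℕ,
      let s' := (fun s => (p.run n s).setReg r ((p.run n s).reg r + 1))^[j] (s.setReg r 0)
      s'.reg r = j ∧ s'.arr 0 = inp ∧ s'.Bounded (L + N + j * (p.growth.eval N + 4 * N)) := by
    intro j
    induction j with
    | zero =>
      exact ⟨by simp [State.setReg], by simpa [State.setReg] using hs0,
        (hs.setReg hL).mono (by omega)⟩
    | succ j ihj =>
      obtain ⟨hj, h1, h2⟩ := ihj
      rw [Function.iterate_succ_apply']
      generalize (fun s => (p.run n s).setReg r ((p.run n s).reg r + 1))^[j] (s.setReg r 0) = s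
        at hj h1 h2 ⊢
      have h3 := hp h1 h2
      have h4 : (p.run n s).arr 0 = inp := by rwa [run_arr n p s h0]
      refine ⟨by simp [State.setReg, run_reg n p s hr, hj], by simpa [State.setReg] using h4, ?_⟩
      have h5 := Expr.bitLength_val_le hin h4 h3 (.add (.reg r) (.const 1)) rfl
      have h6 : bitLength 1 = 2 := by simp [bitLength]
      simp only [Expr.val, Expr.size, h6] at h5
      have h7 : L + N + (j + 1) * (p.growth.eval N + 4 * N) =
        L + N + j * (p.growth.eval N + 4 * N) + p.growth.eval N + 4 * N := by ring
      rw [h7]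
      exact (h3.mono (by omega)).setReg (by convert h5 using 1)
  obtain ⟨h1, h2, h3⟩ := hb j
  refine ⟨h1, h2, h3.mono ?_⟩
  have := Nat.mul_le_mul_right (p.growth.eval N + 4 * N)
    (hj.trans (Nat.pow_le_pow_left hin.order_le k))
  simp only [growth, eval_add, eval_mul, eval_pow, eval_X, eval_ofNat]
  omega

lemma run_bounded (hin : IsInput inp n N) (p : Cmd) (hp : p.tame = true) (h0 : 0 ∉ p.stores)
    {s : State} {L : ℕ} (hs0 : s.arr 0 = inp) (hs : s.Bounded L) :
    (p.run n s).Bounded (L + p.growth.eval N) := by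
  induction p generalizing s L with
  | skip => simpa [run, growth] using hs
  | assign r e =>
    have := Expr.bitLength_val_le hin hs0 hs e hp
    simpa [run, growth] using (hs.mono (Nat.le_add_right _ _)).setReg this
  | store a i e =>
    simp only [tame, Bool.and_eq_true] at hp
    have := Expr.bitLength_val_le hin hs0 hs e hp.2
    simpa [run, growth] using (hs.mono (Nat.le_add_right _ _)).setArr this
  | seq p q ihp ihq =>
    simp only [tame, Bool.and_eq_true] at hp
    simp only [stores, List.mem_append, not_or] at h0
    have := ihq hp.2 h0.2 (by rwa [run_arr n p s h0.1]) (ihp hp.1 h0.1 hs0 hs)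
    simpa [run, growth, add_assoc] using this
  | cond e p q ihp ihq =>
    simp only [tame, Bool.and_eq_true] at hp
    simp only [stores, List.mem_append, not_or] at h0
    simp only [run, growth, eval_add]
    split_ifs
    · exact (ihp hp.1.2 h0.1 hs0 hs).mono (by omega)
    · exact (ihq hp.2 h0.2 hs0 hs).mono (by omega)
  | loop r k p ih =>
    simp only [tame, Bool.and_eq_true] at hp
    simp only [stores] at h0
    have hr : r ∉ p.writes := by simpa using hp.2
    exact (iterate_bounded hin hr h0 (fun h1 h2 => ih hp.1 h0 h1 h2) hs0 hs (n ^ k) le_rfl).2.2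

lemma exprTime_spec (hin : IsInput inp n N) {s : State} {L : ℕ[X]} (hs0 : s.arr 0 = inp)
    (hs : s.Bounded (L.eval N)) (e : Expr) (he : e.tame = true) :
    e.cost s ≤ (exprTime L e).eval N := by
  simpa [exprTime] using Expr.cost_le hin hs0 hs e he

lemma orderPow_tame (k : ℕ) : (Expr.orderPow k).tame = true := by
  induction k with
  | zero => rfl
  | succ k ih => simp [Expr.orderPow, Expr.order, Expr.tame, ih]

lemma orderPow_val (hin : IsInput inp n N) {s : State} (hs0 : s.arr 0 = inp) (k : ℕ) :
    (Expr.orderPow k).val s = (n : ℤ) ^ k := by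
  induction k with
  | zero => simp [Expr.orderPow, Expr.val]
  | succ k ih => simp [Expr.orderPow, Expr.order, Expr.val, ih, hs0, hin.order, pow_succ]

/-- Reduces a loop of the machine to the iterates of a function on states, with uniform bounds `K`
for the test and `K'` for the body. -/
lemma runs_loop {q : Program} {e : Expr} {f : State → State} {K K' : ℕ} (j : ℕ) (s : State)
    (hpos : ∀ i < j, 0 < e.val (f^[i] s)) (hend : e.val (f^[j] s) ≤ 0)
    (hstep : ∀ i < j, ∃ t ≤ K', Runs q (f^[i] s) (f^[i + 1] s) t)
    (hcost : ∀ i ≤ j, e.cost (f^[i] s) ≤ K) :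
    ∃ t ≤ (j + 1) * (1 + K + K'), Runs (.loop e q) s (f^[j] s) t := by
  induction j generalizing s with
  | zero =>
    refine ⟨1 + e.cost s, ?_, .loopNonpos hend⟩
    have := hcost 0 le_rfl
    simp only [Function.iterate_zero, id] at this
    nlinarith
  | succ j ih =>
    obtain ⟨t', ht', hr'⟩ := ih (f s) (fun i hi => hpos (i + 1) (by omega)) hend
      (fun i hi => hstep (i + 1) (by omega)) (fun i hi => hcost (i + 1) (by omega))
    obtain ⟨t, ht, hr⟩ := hstep 0 (by omega)
    have := hcost 0 (by omega)
    simp only [Function.iterate_zero, id] at this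
    refine ⟨1 + e.cost s + t + t', ?_, .loopPos (hpos 0 (by omega)) hr hr'⟩
    nlinarith

/-- Programs with bounded loops and tame multiplications run in polynomial time. -/
theorem runs_compile (hin : IsInput inp n N) (p : Cmd) (hp : p.tame = true) (h0 : 0 ∉ p.stores)
    {s : State} {L : ℕ[X]} (hs0 : s.arr 0 = inp) (hs : s.Bounded (L.eval N)) :
    ∃ t ≤ (time L p).eval N, Runs p.compile s (p.run n s) t := by
  induction p generalizing s L with
  | skip => exact ⟨1, by simp [time], .skip s⟩
  | assign r e =>
    have := exprTime_spec hin hs0 hs e hp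
    exact ⟨_, by simpa [time] using this, .assign s r e⟩
  | store a i e =>
    simp only [tame, Bool.and_eq_true] at hp
    have h1 := exprTime_spec hin hs0 hs i hp.1
    have h2 := exprTime_spec hin hs0 hs e hp.2
    exact ⟨_, by simp only [time, eval_add, eval_one]; omega, .store s a i e⟩
  | seq p q ihp ihq =>
    simp only [tame, Bool.and_eq_true] at hp
    simp only [stores, List.mem_append, not_or] at h0
    obtain ⟨t, ht, hr⟩ := ihp hp.1 h0.1 hs0 hs
    obtain ⟨t', ht', hr'⟩ := ihq (s := p.run n s) (L := L + p.growth) hp.2 h0.2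
      (by rwa [run_arr n p s h0.1]) (by simpa using run_bounded hin p hp.1 h0.1 hs0 hs)
    exact ⟨t + t', by simp only [time, eval_add]; omega, .seq hr hr'⟩
  | cond e p q ihp ihq =>
    simp only [tame, Bool.and_eq_true] at hp
    simp only [stores, List.mem_append, not_or] at h0
    have h1 := exprTime_spec hin hs0 hs e hp.1.1
    simp only [time, eval_add, eval_one, run]
    split_ifs with he
    · obtain ⟨t, ht, hr⟩ := ihp hp.1.2 h0.1 hs0 hs
      exact ⟨1 + e.cost s + t, by omega, .condPos he hr⟩
    · obtain ⟨t, ht, hr⟩ := ihq hp.2 h0.2 hs0 hs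
      exact ⟨1 + e.cost s + t, by omega, .condNonpos (not_lt.1 he) hr⟩
  | loop r k p ih =>
    simp only [tame, Bool.and_eq_true] at hp
    simp only [stores] at h0
    have hr : r ∉ p.writes := by simpa using hp.2
    set f : State → State := fun s => (p.run n s).setReg r ((p.run n s).reg r + 1) with hf
    have hiter : ∀ i ≤ n ^ k, (f^[i] (s.setReg r 0)).reg r = i ∧
        (f^[i] (s.setReg r 0)).arr 0 = inp ∧
        (f^[i] (s.setReg r 0)).Bounded ((L + (loop r k p).growth).eval N) := by
      rw [eval_add]
      exact iterate_bounded hin hr h0 (run_bounded hin p hp.1 h0) hs0 hs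
    have htest : ∀ i ≤ n ^ k, (Expr.sub (.orderPow k) (.reg r)).val (f^[i] (s.setReg r 0)) =
        (n : ℤ) ^ k - i := by
      intro i hi
      simp [Expr.val, orderPow_val hin (hiter i hi).2.1, (hiter i hi).1]
    obtain ⟨t, ht, hrun⟩ := runs_loop (q := .seq p.compile (.assign r (.add (.reg r) (.const 1))))
      (e := .sub (.orderPow k) (.reg r)) (f := f)
      (K := (exprTime (L + (loop r k p).growth) (.sub (.orderPow k) (.reg r))).eval N)
      (K' := (time (L + (loop r k p).growth) p + (1 + exprTime
        (L + (loop r k p).growth + p.growth) (.add (.reg r) (.const 1)))).eval N)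
      (n ^ k) (s.setReg r 0)
      (fun i hi => by rw [htest i hi.le, sub_pos]; exact_mod_cast hi)
      (by rw [htest _ le_rfl]; simp)
      (fun i hi => by
        obtain ⟨h1, h2, h3⟩ := hiter i hi.le
        rw [Function.iterate_succ_apply']
        generalize f^[i] (s.setReg r 0) = s at h1 h2 h3 ⊢
        obtain ⟨t, ht, hrun⟩ := ih hp.1 h0 h2 h3
        have h4 := exprTime_spec hin (s := p.run n s) (by rwa [run_arr n p s h0])
          (by simpa using run_bounded hin p hp.1 h0 h2 h3)
          (L := L + (loop r k p).growth + p.growth) (.add (.reg r) (.const 1)) rfl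
        refine ⟨_, ?_, .seq hrun (.assign _ _ _)⟩
        simp only [eval_add, eval_one] at ht h4 ⊢
        omega)
      (fun i hi => exprTime_spec hin (hiter i hi).2.1 (hiter i hi).2.2 _
        (by simp [Expr.tame, orderPow_tame]))
    have h9 := exprTime_spec hin hs0 hs (.const 0) rfl
    refine ⟨_, ?_, .seq (.assign _ _ _) hrun⟩
    have h10 : n ^ k ≤ N ^ k := Nat.pow_le_pow_left hin.order_le k
    simp only [time, eval_add, eval_mul, eval_pow, eval_X, eval_one] at ht h9 ⊢
    refine add_le_add (by omega) (ht.trans ?_)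
    exact Nat.mul_le_mul (by omega) (by omega)

end Cmd

/-! ### Initial states. -/

lemma bitLength_le_wordLength {x : List ℤ} {z : ℤ} (h : z ∈ x) : bitLength z ≤ wordLength x :=
  List.single_le_sum (by simp) _ (List.mem_map_of_mem h)

lemma length_le_wordLength (x : List ℤ) : x.length ≤ wordLength x := by
  unfold wordLength
  simpa using List.card_nsmul_le_sum (x.map bitLength) 1 (by
    intro y hy
    obtain ⟨z, _, rfl⟩ := List.mem_map.1 hy
    exact bitLength_pos z)

lemma init_bounded (x : List ℤ) : (State.init x).Bounded (wordLength x + 1) := by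
  have h0 : bitLength 0 ≤ wordLength x + 1 := by simp [bitLength]
  refine ⟨fun r => ?_, fun a i => ?_⟩
  · simp only [State.init]
    split_ifs
    · exact (bitLength_natCast_le _).trans (by simpa using length_le_wordLength x)
    · exact h0
  · simp only [State.init]
    split_ifs
    · rw [List.getD_eq_getElem?_getD]
      rcases h : x[i.toNat]? with _ | z
      · simpa using h0
      · exact (bitLength_le_wordLength (List.mem_of_getElem? h)).trans (Nat.le_succ _)
    · exact h0

/-- A program with bounded loops runs in polynomial time on all inputs whose first entry is at most
their length. -/
theorem Cmd.runs_init (p : Cmd) (hp : p.tame = true) (h0 : 0 ∉ p.stores) :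
    ∃ T : Polynomial ℕ, ∀ (x : List ℤ) (n : ℕ), n ≤ x.length → x.head? = some (n : ℤ) →
      ∃ t ≤ T.eval (wordLength x), Runs p.compile (State.init x) (p.run n (State.init x)) t := by
  -- The word length plus one serves both as `N` and as the initial length bound. The extra one pays
  -- for the sign bit of the word's length in register `0` and for the default value `0` when the
  -- word is empty.
  refine ⟨(time Polynomial.X p).comp (Polynomial.X + 1), fun x n hn hx => ?_⟩
  have hb := init_bounded x
  have hin : IsInput ((State.init x).arr 0) n (wordLength x + 1) :=
    ⟨by
      obtain ⟨l, rfl⟩ : ∃ l, x = (n : ℤ) :: l := by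
        cases x <;> simp_all
      simp [State.init], (hn.trans (length_le_wordLength x)).trans (Nat.le_succ _), hb.arr 0⟩
  simpa using runs_compile hin p hp h0 rfl (L := Polynomial.X) (by simpa using hb)

end RAM

/-! ### Relations without induced paths on four vertices -/

namespace Cograph

variable {E : Type*} [DecidableEq E]

/-- The finite set `A` is built from sets with at most one element by disjoint unions and joins. -/
inductive IsCographOn (r : E → E → Prop) : Finset E → Prop where
  | small {A : Finset E} (h : A.card ≤ 1) : IsCographOn r A
  | union {B C : Finset E} (hB : IsCographOn r B) (hC : IsCographOn r C)
      (h : ∀ b ∈ B, ∀ c ∈ C, ¬ r b c ∧ ¬ r c b) : IsCographOn r (B ∪ C)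
  | join {B C : Finset E} (hB : IsCographOn r B) (hC : IsCographOn r C)
      (h : ∀ b ∈ B, ∀ c ∈ C, r b c ∧ r c b) : IsCographOn r (B ∪ C)

lemma IsCographOn.subset {r : E → E → Prop} {A : Finset E} (h : IsCographOn r A) :
    ∀ {A' : Finset E}, A' ⊆ A → IsCographOn r A' := by
  induction h with
  | small h => exact fun hA => .small ((Finset.card_le_card hA).trans h)
  | @union B C _ _ h ihB ihC =>
    intro A' hA
    have : A' = (A' ∩ B) ∪ (A' ∩ C) := by
      rw [← Finset.inter_union_distrib_left, Finset.inter_eq_left.2 hA]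
    rw [this]
    exact .union (ihB Finset.inter_subset_right) (ihC Finset.inter_subset_right)
      fun b hb c hc => h b (Finset.mem_inter.1 hb).2 c (Finset.mem_inter.1 hc).2
  | @join B C _ _ h ihB ihC =>
    intro A' hA
    have : A' = (A' ∩ B) ∪ (A' ∩ C) := by
      rw [← Finset.inter_union_distrib_left, Finset.inter_eq_left.2 hA]
    rw [this]
    exact .join (ihB Finset.inter_subset_right) (ihC Finset.inter_subset_right)
      fun b hb c hc => h b (Finset.mem_inter.1 hb).2 c (Finset.mem_inter.1 hc).2

lemma IsCographOn.congr {r r' : E → E → Prop} {A : Finset E} (h : IsCographOn r A)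
    (hrr' : ∀ a ∈ A, ∀ b ∈ A, (r a b ↔ r' a b)) : IsCographOn r' A := by
  induction h with
  | small h => exact .small h
  | @union B C _ _ h ihB ihC =>
    have hB : B ⊆ B ∪ C := Finset.subset_union_left
    have hC : C ⊆ B ∪ C := Finset.subset_union_right
    refine .union (ihB fun a ha b hb => hrr' a (hB ha) b (hB hb))
      (ihC fun a ha b hb => hrr' a (hC ha) b (hC hb)) fun b hb c hc => ?_
    rw [← hrr' b (hB hb) c (hC hc), ← hrr' c (hC hc) b (hB hb)]
    exact h b hb c hc
  | @join B C _ _ h ihB ihC =>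
    have hB : B ⊆ B ∪ C := Finset.subset_union_left
    have hC : C ⊆ B ∪ C := Finset.subset_union_right
    refine .join (ihB fun a ha b hb => hrr' a (hB ha) b (hB hb))
      (ihC fun a ha b hb => hrr' a (hC ha) b (hC hb)) fun b hb c hc => ?_
    rw [← hrr' b (hB hb) c (hC hc), ← hrr' c (hC hc) b (hB hb)]
    exact h b hb c hc

/-- A clique is built by joining its elements one at a time. -/
lemma isCographOn_of_forall {r : E → E → Prop} {A : Finset E} (h : ∀ a ∈ A, ∀ b ∈ A, r a b) :
    IsCographOn r A := by
  induction A using Finset.induction_on with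
  | empty => exact .small (by simp)
  | insert v A _ ih =>
    rw [Finset.insert_eq]
    refine .join (.small (by simp)) (ih fun a ha b hb =>
      h a (Finset.mem_insert_of_mem ha) b (Finset.mem_insert_of_mem hb)) fun b hb c hc => ?_
    rw [Finset.mem_singleton] at hb
    subst hb
    exact ⟨h _ (Finset.mem_insert_self _ _) _ (Finset.mem_insert_of_mem hc),
      h _ (Finset.mem_insert_of_mem hc) _ (Finset.mem_insert_self _ _)⟩

/-- The elements of `A` other than `u` and `v` do not distinguish `u` from `v`. -/
def Twins (r : E → E → Prop) (A : Finset E) (u v : E) : Prop :=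
  ∀ x ∈ A, x ≠ u → x ≠ v → (r u x ↔ r v x)

/-- Elements outside a part do not distinguish elements of that part, so twins of a part are twins
of the union. If neither part has two elements, the union has exactly two, and these are twins
vacuously. The uniformity hypotheses cover unions and joins alike. -/
lemma exists_twins_of_uniform {r : E → E → Prop} {B C : Finset E}
    (ihB : 2 ≤ B.card → ∃ u ∈ B, ∃ v ∈ B, u ≠ v ∧ Twins r B u v)
    (ihC : 2 ≤ C.card → ∃ u ∈ C, ∃ v ∈ C, u ≠ v ∧ Twins r C u v)
    (hB : ∀ u ∈ B, ∀ v ∈ B, ∀ x ∈ C, (r u x ↔ r v x))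
    (hC : ∀ u ∈ C, ∀ v ∈ C, ∀ x ∈ B, (r u x ↔ r v x)) (h : 2 ≤ (B ∪ C).card) :
    ∃ u ∈ B ∪ C, ∃ v ∈ B ∪ C, u ≠ v ∧ Twins r (B ∪ C) u v := by
  by_cases h1 : 2 ≤ B.card
  · obtain ⟨u, hu, v, hv, huv, ht⟩ := ihB h1
    refine ⟨u, Finset.mem_union_left _ hu, v, Finset.mem_union_left _ hv, huv,
      fun x hx hxu hxv => ?_⟩
    rcases Finset.mem_union.1 hx with hx | hx
    exacts [ht x hx hxu hxv, hB u hu v hv x hx]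
  by_cases h2 : 2 ≤ C.card
  · obtain ⟨u, hu, v, hv, huv, ht⟩ := ihC h2
    refine ⟨u, Finset.mem_union_right _ hu, v, Finset.mem_union_right _ hv, huv,
      fun x hx hxu hxv => ?_⟩
    rcases Finset.mem_union.1 hx with hx | hx
    exacts [hC u hu v hv x hx, ht x hx hxu hxv]
  have := Finset.card_union_le B C
  obtain ⟨u, v, huv, heq⟩ := Finset.card_eq_two.1 (show (B ∪ C).card = 2 by omega)
  rw [heq]
  refine ⟨u, by simp, v, by simp, huv, fun x hx hxu hxv => ?_⟩
  simp [hxu, hxv] at hx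

lemma IsCographOn.exists_twins {r : E → E → Prop} {A : Finset E} (h : IsCographOn r A)
    (hA : 2 ≤ A.card) : ∃ u ∈ A, ∃ v ∈ A, u ≠ v ∧ Twins r A u v := by
  induction h with
  | small h => omega
  | union _ _ h ihB ihC =>
    exact exists_twins_of_uniform ihB ihC
      (fun u hu v hv x hx => by simp [h u hu x hx, h v hv x hx])
      (fun u hu v hv x hx => by simp [h x hx u hu, h x hx v hv]) hA
  | join _ _ h ihB ihC =>
    exact exists_twins_of_uniform ihB ihC
      (fun u hu v hv x hx => by simp [h u hu x hx, h v hv x hx])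
      (fun u hu v hv x hx => by simp [h x hx u hu, h x hx v hv]) hA

/-- There is no induced path on four vertices. -/
def NoP4 (r : E → E → Prop) : Prop :=
  ∀ a b c d, r a b → r b c → r c d → r a c ∨ r a d ∨ r b d

/-- A nontrivial partition of `A` into two sets that are completely joined, or not joined at all. -/
def Splits (r : E → E → Prop) (A : Finset E) : Prop :=
  ∃ B C : Finset E, B.Nonempty ∧ C.Nonempty ∧ Disjoint B C ∧ B ∪ C = A ∧
    ((∀ b ∈ B, ∀ c ∈ C, r b c) ∨ ∀ b ∈ B, ∀ c ∈ C, ¬ r b c)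

/-- If `v` has a neighbour `c` in `C`, then no neighbour `y` of `v` in `B` is adjacent to a
non-neighbour `z` in `B`, since `c v y z` would be an induced path; so the non-neighbours in `B`
separate from the rest. They include `x`. If `v` has no neighbour in `C`, then `C` separates. -/
lemma splits_insert_aux {r : E → E → Prop} (hr : ∀ ⦃x y⦄, r x y → r y x) (h : NoP4 r)
    {B C : Finset E} {v x : E}
    (hv : v ∉ B ∪ C) (hC : C.Nonempty) (hd : Disjoint B C)
    (hBC : ∀ b ∈ B, ∀ c ∈ C, ¬ r b c) (hx : x ∈ B) (hvx : ¬ r v x) :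
    Splits r (insert v (B ∪ C)) := by
  classical
  by_cases h1 : ∃ c ∈ C, r v c
  · obtain ⟨c, hc, hvc⟩ := h1
    have h2 : ∀ y ∈ B, ∀ z ∈ B, r v y → ¬ r v z → ¬ r y z := by
      intro y hy z hz hvy hvz hyz
      rcases h c v y z (hr hvc) hvy hyz with h | h | h
      exacts [hBC y hy c hc (hr h), hBC z hz c hc (hr h), hvz h]
    refine ⟨B.filter (fun z => ¬ r v z), insert v (B.filter (fun z => r v z) ∪ C),
      ⟨x, by simp [hx, hvx]⟩, by simp, ?_, ?_, .inr ?_⟩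
    · rw [Finset.disjoint_left]
      intro z hz hz'
      simp only [Finset.mem_filter, Finset.mem_insert, Finset.mem_union] at hz hz' hv
      rcases hz' with rfl | hz' | hz'
      exacts [hv (.inl hz.1), hz.2 hz'.2, Finset.disjoint_left.1 hd hz.1 hz']
    · ext z
      simp only [Finset.mem_filter, Finset.mem_insert, Finset.mem_union]
      tauto
    · intro z hz y hy hzy
      simp only [Finset.mem_filter, Finset.mem_insert, Finset.mem_union] at hz hy
      rcases hy with rfl | hy | hy
      exacts [hz.2 (hr hzy), h2 y hy.1 z hz.1 hy.2 hz.2 (hr hzy), hBC z hz.1 y hy hzy]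
  · push Not at h1
    refine ⟨C, insert v B, hC, by simp, ?_, ?_, .inr ?_⟩
    · rw [Finset.disjoint_insert_right]
      exact ⟨fun h => hv (Finset.mem_union_right _ h), hd.symm⟩
    · ext z
      simp only [Finset.mem_insert, Finset.mem_union]
      tauto
    · intro c hc b hb hcb
      rcases Finset.mem_insert.1 hb with rfl | hb
      exacts [h1 c hc (hr hcb), hBC b hb c hc (hr hcb)]

lemma splits_insert {r : E → E → Prop} (hr : ∀ ⦃x y⦄, r x y → r y x) (h : NoP4 r)
    {B C : Finset E} {v : E}
    (hv : v ∉ B ∪ C) (hB : B.Nonempty) (hC : C.Nonempty) (hd : Disjoint B C)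
    (hBC : ∀ b ∈ B, ∀ c ∈ C, ¬ r b c) : Splits r (insert v (B ∪ C)) := by
  by_cases h1 : ∀ x ∈ B ∪ C, r v x
  · refine ⟨{v}, B ∪ C, by simp, hB.mono Finset.subset_union_left, by simpa using hv,
      (Finset.insert_eq _ _).symm, .inl (by simpa using h1)⟩
  · push Not at h1
    obtain ⟨x, hx, hvx⟩ := h1
    rcases Finset.mem_union.1 hx with hx | hx
    · exact splits_insert_aux hr h hv hC hd hBC hx hvx
    · rw [Finset.union_comm] at hv ⊢
      exact splits_insert_aux hr h hv hB hd.symm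
        (fun c hc b hb hcb => hBC b hb c hc (hr hcb)) hx hvx

-- The path on four vertices is self-complementary: an induced path `a b c d` of the complement is
-- an induced path `b d a c` of `r`.
omit [DecidableEq E] in
lemma NoP4.compl {r : E → E → Prop} (hr : ∀ ⦃x y⦄, r x y → r y x) (h : NoP4 r) :
    NoP4 (fun x y => x ≠ y ∧ ¬ r x y) := by
  intro a b c d hab hbc hcd
  by_contra! hcon
  obtain ⟨h1, h2, h3⟩ := hcon
  have hac : a ≠ c := by rintro rfl; exact hcd.2 (h2 hcd.1)
  have had : a ≠ d := by rintro rfl; exact hab.2 (hr (h3 hab.1.symm))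
  have hbd : b ≠ d := by rintro rfl; exact hab.2 (h2 hab.1)
  rcases h b d a c (h3 hbd) (hr (h2 had)) (h1 hac) with h | h | h
  exacts [hab.2 (hr h), hbc.2 h, hcd.2 (hr h)]

lemma Splits.of_compl {r : E → E → Prop} {A : Finset E}
    (h : Splits (fun x y => x ≠ y ∧ ¬ r x y) A) : Splits r A := by
  obtain ⟨B, C, hB, hC, hd, hA, h⟩ := h
  refine ⟨B, C, hB, hC, hd, hA, h.symm.imp (fun h b hb c hc => ?_) fun h b hb c hc =>
    (h b hb c hc).2⟩
  by_contra hr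
  exact h b hb c hc ⟨fun hbc => Finset.disjoint_left.1 hd hb (hbc ▸ hc), hr⟩

/-- Seinsche's theorem. -/
lemma NoP4.splits {r : E → E → Prop} (hr : ∀ ⦃x y⦄, r x y → r y x) (h : NoP4 r) (A : Finset E)
    (hA : 2 ≤ A.card) : Splits r A := by
  induction A using Finset.induction_on with
  | empty => simp at hA
  | insert v A hv ih =>
    rw [Finset.card_insert_of_notMem hv] at hA
    by_cases hA' : 2 ≤ A.card
    · obtain ⟨B, C, hB, hC, hd, rfl, h1 | h1⟩ := ih hA'
      -- A join is a disjoint union in the complement, so the same extension step is applied there.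
      · exact .of_compl (splits_insert (fun x y hxy => ⟨hxy.1.symm, fun h => hxy.2 (hr h)⟩)
          (h.compl hr) hv hB hC hd fun b hb c hc h2 => h2.2 (h1 b hb c hc))
      · exact splits_insert hr h hv hB hC hd h1
    · obtain ⟨x, rfl⟩ := Finset.card_eq_one.1 (show A.card = 1 by omega)
      refine ⟨{v}, {x}, by simp, by simp, by simpa using hv, rfl, ?_⟩
      simpa using em _

lemma NoP4.isCographOn {r : E → E → Prop} (hr : ∀ ⦃x y⦄, r x y → r y x) (h : NoP4 r)
    (A : Finset E) :
    IsCographOn r A := by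
  induction A using Finset.strongInduction with
  | H A ih =>
    by_cases hA : 2 ≤ A.card
    · obtain ⟨B, C, ⟨b, hb⟩, ⟨c, hc⟩, hd, rfl, h1⟩ := h.splits hr A hA
      have hB := ih B (Finset.ssubset_iff_of_subset Finset.subset_union_left |>.2
        ⟨c, by simp [hc], Finset.disjoint_right.1 hd hc⟩)
      have hC := ih C (Finset.ssubset_iff_of_subset Finset.subset_union_right |>.2
        ⟨b, by simp [hb], Finset.disjoint_left.1 hd hb⟩)
      rcases h1 with h1 | h1
      · exact .join hB hC fun b hb c hc => ⟨h1 b hb c hc, hr (h1 b hb c hc)⟩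
      · exact .union hB hC fun b hb c hc => ⟨h1 b hb c hc, fun h => h1 b hb c hc (hr h)⟩
    · exact .small (by omega)

/-- Let `e ∈ A` be pairs `(s e, t e)` with `r (s e) (t e)`, and let two pairs be related if some
of their entries are. If the entries form a cograph, then so do the pairs. -/
lemma IsCographOn.pairs {F : Type*} [DecidableEq F] {r : E → E → Prop} (hr : ∀ ⦃x y⦄, r x y → r y x)
    (hirr : ∀ x, ¬ r x x) {s t : F → E} {A : Finset F} (hA : ∀ e ∈ A, r (s e) (t e))
    {B : Finset E} (hB : IsCographOn r B) :
    IsCographOn (fun e f => r (s e) (s f) ∨ r (s e) (t f) ∨ r (t e) (s f) ∨ r (t e) (t f))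
      (A.filter fun e => s e ∈ B ∧ t e ∈ B) := by
  have hsymm : ∀ e f, (r (s e) (s f) ∨ r (s e) (t f) ∨ r (t e) (s f) ∨ r (t e) (t f)) →
      (r (s f) (s e) ∨ r (s f) (t e) ∨ r (t f) (s e) ∨ r (t f) (t e)) := by
    rintro e f (h | h | h | h) <;> simp [hr h]
  induction hB with
  | @small B h =>
    refine .small ?_
    rw [Finset.filter_false_of_mem]
    · simp
    · intro e he h1
      have := hA e he
      rw [Finset.card_le_one.1 h _ h1.1 _ h1.2] at this
      exact hirr _ this
  | @union B C _ _ h ihB ihC =>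
    -- No relation crosses between `B` and `C`, so the entries of each pair lie in the same part.
    refine (IsCographOn.union ihB ihC ?_).subset ?_
    · intro e he f hf
      simp only [Finset.mem_filter] at he hf
      have : ¬ (r (s e) (s f) ∨ r (s e) (t f) ∨ r (t e) (s f) ∨ r (t e) (t f)) := by
        simp [h _ he.2.1 _ hf.2.1, h _ he.2.1 _ hf.2.2, h _ he.2.2 _ hf.2.1, h _ he.2.2 _ hf.2.2]
      exact ⟨this, fun h => this (hsymm _ _ h)⟩
    · intro e he
      simp only [Finset.mem_filter, Finset.mem_union] at he ⊢
      have := hA e he.1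
      rcases he.2.1 with h1 | h1 <;> rcases he.2.2 with h2 | h2
      · exact .inl ⟨he.1, h1, h2⟩
      · exact absurd this (h _ h1 _ h2).1
      · exact absurd this (h _ h2 _ h1).2
      · exact .inr ⟨he.1, h1, h2⟩
  | @join B C _ _ h ihB ihC =>
    -- A pair with one entry in each part conflicts with every pair considered here: whichever part
    -- contains an entry of the other pair, this pair has an entry in the opposite part. Hence the
    -- crossing pairs form a clique joined to all the others.
    have hcross : IsCographOn
        (fun e f => r (s e) (s f) ∨ r (s e) (t f) ∨ r (t e) (s f) ∨ r (t e) (t f))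
        (A.filter fun e => (s e ∈ B ∧ t e ∈ C) ∨ (s e ∈ C ∧ t e ∈ B)) := by
      refine isCographOn_of_forall fun e he f hf => ?_
      simp only [Finset.mem_filter] at he hf
      rcases he.2 with ⟨h1, h2⟩ | ⟨h1, h2⟩ <;> rcases hf.2 with ⟨h3, h4⟩ | ⟨h3, h4⟩
      · exact .inr (.inl (h _ h1 _ h4).1)
      · exact .inl (h _ h1 _ h3).1
      · exact .inl (h _ h3 _ h1).2
      · exact .inr (.inl (h _ h4 _ h1).2)
    refine (IsCographOn.join (IsCographOn.join ihB ihC ?_) hcross ?_).subset ?_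
    · intro e he f hf
      simp only [Finset.mem_filter] at he hf
      have := h _ he.2.1 _ hf.2.1
      exact ⟨.inl this.1, .inl this.2⟩
    · intro e he f hf
      simp only [Finset.mem_filter, Finset.mem_union] at he hf
      have : r (s e) (s f) ∨ r (s e) (t f) ∨ r (t e) (s f) ∨ r (t e) (t f) := by
        rcases he with ⟨-, h1, -⟩ | ⟨-, h1, -⟩ <;> rcases hf.2 with ⟨h3, h4⟩ | ⟨h3, h4⟩
        · exact .inr (.inl (h _ h1 _ h4).1)
        · exact .inl (h _ h1 _ h3).1
        · exact .inl (h _ h3 _ h1).2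
        · exact .inr (.inl (h _ h4 _ h1).2)
      exact ⟨this, hsymm _ _ this⟩
    · intro e he
      simp only [Finset.mem_filter, Finset.mem_union] at he ⊢
      tauto

/-! ### Maximum weight independent sets by elimination of twins -/

/-- No two elements of `I` are related. -/
def Indep (c : E → E → Prop) (I : Finset E) : Prop := ∀ x ∈ I, ∀ y ∈ I, x ≠ y → ¬ c x y

/-- The elements `u` of `A`, with weights `w u`, represent the disjoint independent sets
`{f ∈ U | own f = u}` of `A₀`, with weights `w₀`, in such a way that unions of these sets are
optimal among all independent subsets of `A₀`. -/
structure Represents (c : E → E → Prop) (U A₀ : Finset E) (w₀ : E → ℤ) (A : Finset E) (w : E → ℤ)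
    (own : E → E) : Prop where
  subset : A ⊆ A₀
  nonneg : ∀ u ∈ A, 0 ≤ w u
  weight : ∀ u ∈ A, w u = ∑ f ∈ U with own f = u, w₀ f
  mem : ∀ f ∈ U, own f ∈ A → f ∈ A₀
  -- Conflicts of represented elements are visible at their owners; in particular, elements with the
  -- same owner do not conflict.
  indep : ∀ f ∈ U, ∀ g ∈ U, own f ∈ A → own g ∈ A → f ≠ g → c f g →
    own f ≠ own g ∧ c (own f) (own g)
  opt : ∀ J ⊆ A₀, Indep c J → ∃ I ⊆ A, Indep c I ∧ ∑ f ∈ J, w₀ f ≤ ∑ u ∈ I, w u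

namespace Represents

variable {c : E → E → Prop} {U A₀ A : Finset E} {w₀ w : E → ℤ} {own : E → E}

lemma refl (hA₀ : A₀ ⊆ U) (h0 : ∀ u ∈ A₀, 0 ≤ w₀ u) (hown : ∀ f ∈ U, own f = f)
    (hw : ∀ u ∈ A₀, w u = w₀ u) : Represents c U A₀ w₀ A₀ w own where
  subset := subset_rfl
  nonneg u hu := by rw [hw u hu]; exact h0 u hu
  weight u hu := by
    have : (U.filter fun f => own f = u) = {u} := by
      ext f
      simp only [Finset.mem_filter, Finset.mem_singleton]
      refine ⟨fun h => (hown f h.1) ▸ h.2, ?_⟩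
      rintro rfl
      exact ⟨hA₀ hu, hown _ (hA₀ hu)⟩
    simp [this, hw u hu]
  mem f hf h := by rwa [hown f hf] at h
  indep f hf g hg _ _ hfg h := by rw [hown f hf, hown g hg]; exact ⟨hfg, h⟩
  opt J hJ hI := ⟨J, hJ, hI, (Finset.sum_congr rfl fun u hu => (hw u (hJ hu)).symm).le⟩

/-- Twins have the same conflicts with all other elements, so `u` can take the place of `v`. This
moves an optimal independent set away from the element `v` that is eliminated. -/
lemma indep_swap {I : Finset E} {u v : E} (hs : ∀ ⦃x y⦄, c x y → c y x) (ht : Twins c A u v)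
    (hI : I ⊆ A) (hc : Indep c I) (hu : u ∈ I ∨ v ∈ I) : Indep c (insert u (I.erase v)) := by
  have hkey : ∀ y ∈ I, y ≠ u → y ≠ v → ¬ c u y := by
    intro y hy hyu hyv h
    rcases hu with hu | hu
    · exact hc u hu y hy hyu.symm h
    · exact hc v hu y hy hyv.symm ((ht y (hI hy) hyu hyv).1 h)
  intro x hx y hy hxy h
  simp only [Finset.mem_insert, Finset.mem_erase] at hx hy
  rcases hx with rfl | hx <;> rcases hy with rfl | hy
  · exact hxy rfl
  · exact hkey y hy.2 hxy.symm hy.1 h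
  · exact hkey x hx.2 hxy hx.1 (hs h)
  · exact hc x hx.2 y hy.2 hxy h

lemma insert_erase_subset {I : Finset E} {u v : E} (hI : I ⊆ A) (huA : u ∈ A) (huv : u ≠ v) :
    insert u (I.erase v) ⊆ A.erase v := by
  intro x hx
  simp only [Finset.mem_insert, Finset.mem_erase] at hx ⊢
  rcases hx with rfl | hx
  exacts [⟨huv, huA⟩, ⟨hx.1, hI hx.2⟩]

/-- The lighter one of two related twins may be dropped. -/
lemma erase (h : Represents c U A₀ w₀ A w own) (hs : ∀ ⦃x y⦄, c x y → c y x) {u v : E} (hu : u ∈ A)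
    (huv : u ≠ v) (ht : Twins c A u v) (hc : c u v) (hw : w v ≤ w u) :
    Represents c U A₀ w₀ (A.erase v) w own where
  subset := (Finset.erase_subset _ _).trans h.subset
  nonneg x hx := h.nonneg x (Finset.mem_of_mem_erase hx)
  weight x hx := h.weight x (Finset.mem_of_mem_erase hx)
  mem f hf hx := h.mem f hf (Finset.mem_of_mem_erase hx)
  indep f hf g hg hx hy :=
    h.indep f hf g hg (Finset.mem_of_mem_erase hx) (Finset.mem_of_mem_erase hy)
  opt J hJ hJc := by
    obtain ⟨I, hI, hIc, hle⟩ := h.opt J hJ hJc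
    by_cases hv : v ∈ I
    · refine ⟨insert u (I.erase v), insert_erase_subset hI hu huv,
        indep_swap hs ht hI hIc (.inr hv), hle.trans ?_⟩
      -- The conflict keeps `u` and `v` from both lying in `I`, so the exchange replaces `w v` by
      -- the weight `w u`, which is at least as large.
      have huI : u ∉ I := fun huI => hIc u huI v hv huv hc
      rw [Finset.sum_insert (by simp [huI]), ← Finset.add_sum_erase I w hv]
      linarith
    · exact ⟨I, fun x hx => Finset.mem_erase.2 ⟨fun h => hv (h ▸ hx), hI hx⟩, hIc, hle⟩

/-- Two unrelated twins may be merged. -/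
lemma merge (h : Represents c U A₀ w₀ A w own) (hs : ∀ ⦃x y⦄, c x y → c y x) {u v : E} (hu : u ∈ A)
    (hv : v ∈ A) (huv : u ≠ v) (ht : Twins c A u v) (hc : ¬ c u v) {w' : E → ℤ} {own' : E → E}
    (hwu : w' u = w u + w v) (hw : ∀ x ∈ A, x ≠ u → w' x = w x)
    (hown : ∀ f ∈ U, own' f = if own f = v then u else own f) :
    Represents c U A₀ w₀ (A.erase v) w' own' := by
  have hmem : ∀ f ∈ U, own' f ∈ A.erase v → own f ∈ A := by
    intro f hf hx
    rw [hown f hf] at hx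
    split_ifs at hx with h1
    · rwa [h1]
    · exact Finset.mem_of_mem_erase hx
  refine ⟨(Finset.erase_subset _ _).trans h.subset, fun x hx => ?_, fun x hx => ?_,
    fun f hf hx => h.mem f hf (hmem f hf hx), fun f hf g hg hx hy hfg hcfg => ?_,
    fun J hJ hJc => ?_⟩
  · by_cases hxu : x = u
    · rw [hxu, hwu]
      exact add_nonneg (h.nonneg u hu) (h.nonneg v hv)
    · rw [hw x (Finset.mem_of_mem_erase hx) hxu]
      exact h.nonneg x (Finset.mem_of_mem_erase hx)
  · have hxv := Finset.ne_of_mem_erase hx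
    by_cases hxu : x = u
    · subst hxu
      rw [hwu, h.weight _ hu, h.weight v hv, ← Finset.sum_union]
      · refine Finset.sum_congr ?_ fun _ _ => rfl
        ext f
        simp only [Finset.mem_union, Finset.mem_filter]
        constructor
        · rintro (⟨hf, h1⟩ | ⟨hf, h1⟩) <;> refine ⟨hf, ?_⟩ <;> simp [hown f hf, h1]
        · rintro ⟨hf, h1⟩
          rw [hown f hf] at h1
          split_ifs at h1 with h2
          exacts [.inr ⟨hf, h2⟩, .inl ⟨hf, h1⟩]
      · rw [Finset.disjoint_left]
        intro f h1 h2
        simp only [Finset.mem_filter] at h1 h2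
        exact huv (h1.2.symm.trans h2.2)
    · rw [hw x (Finset.mem_of_mem_erase hx) hxu, h.weight x (Finset.mem_of_mem_erase hx)]
      refine Finset.sum_congr (Finset.filter_congr fun f hf => ?_) fun _ _ => rfl
      rw [hown f hf]
      split_ifs with h1
      · rw [h1]
        exact ⟨fun h => absurd h.symm hxv, fun h => absurd h.symm hxu⟩
      · rfl
  -- Only the owner `v` changes, to its twin `u`, which has the same conflicts elsewhere. The old
  -- owners cannot be `u` and `v` themselves, because these do not conflict.
  · obtain ⟨h1, h2⟩ := h.indep f hf g hg (hmem f hf hx) (hmem g hg hy) hfg hcfg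
    have hfA := hmem f hf hx
    have hgA := hmem g hg hy
    rw [hown f hf, hown g hg]
    split_ifs with h3 h4 h4
    · exact absurd (h3.trans h4.symm) h1
    · have hgu : own g ≠ u := fun h5 => hc (hs (by rwa [h3, h5] at h2))
      exact ⟨hgu.symm, (ht _ hgA hgu h4).2 (h3 ▸ h2)⟩
    · have hfu : own f ≠ u := fun h5 => hc (by rwa [h4, h5] at h2)
      exact ⟨hfu, hs ((ht _ hfA hfu h3).2 (hs (h4 ▸ h2)))⟩
    · exact ⟨h1, h2⟩
  · obtain ⟨I, hI, hIc, hle⟩ := h.opt J hJ hJc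
    by_cases huI : u ∈ I ∨ v ∈ I
    · refine ⟨insert u (I.erase v), insert_erase_subset hI hu huv,
        indep_swap hs ht hI hIc huI, hle.trans ?_⟩
      -- The set `I` may contain only one of the twins; nonnegativity of the weights makes taking
      -- both no worse.
      have h1 : ∑ x ∈ I, w x ≤ w u + w v + ∑ x ∈ (I.erase v).erase u, w x := by
        have hu0 := h.nonneg u hu
        have hv0 := h.nonneg v hv
        have e1 : ∑ x ∈ I, w x ≤ w v + ∑ x ∈ I.erase v, w x := by
          by_cases hvI : v ∈ I
          · rw [Finset.add_sum_erase I w hvI]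
          · rw [Finset.erase_eq_of_notMem hvI]; omega
        have e2 : ∑ x ∈ I.erase v, w x ≤ w u + ∑ x ∈ (I.erase v).erase u, w x := by
          by_cases huI : u ∈ I.erase v
          · rw [Finset.add_sum_erase _ w huI]
          · rw [Finset.erase_eq_of_notMem huI]; omega
        omega
      have h2 : insert u (I.erase v) = insert u ((I.erase v).erase u) := by
        ext x
        simp only [Finset.mem_insert, Finset.mem_erase]
        tauto
      rw [h2, Finset.sum_insert (Finset.notMem_erase _ _), hwu]
      refine h1.trans (add_le_add le_rfl (Finset.sum_le_sum fun x hx => ?_))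
      simp only [Finset.mem_erase] at hx
      exact (hw x (hI hx.2.2) hx.1).ge
    · push Not at huI
      refine ⟨I, fun x hx => Finset.mem_erase.2 ⟨fun h => huI.2 (h ▸ hx), hI hx⟩, hIc,
        hle.trans (Finset.sum_le_sum fun x hx => ?_)⟩
      exact (hw x (hI hx) fun h => huI.1 (h ▸ hx)).ge

/-- If at most one element is left, then the represented set is an optimal one. -/
lemma optimal (h : Represents c U A₀ w₀ A w own) (hA : A.card ≤ 1) :
    (U.filter fun f => own f ∈ A) ⊆ A₀ ∧ Indep c (U.filter fun f => own f ∈ A) ∧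
    ∀ J ⊆ A₀, Indep c J → ∑ f ∈ J, w₀ f ≤ ∑ f ∈ U with own f ∈ A, w₀ f := by
  refine ⟨fun f hf => ?_, fun f hf g hg hfg hc => ?_, fun J hJ hJc => ?_⟩
  · rw [Finset.mem_filter] at hf
    exact h.mem f hf.1 hf.2
  · rw [Finset.mem_filter] at hf hg
    exact (h.indep f hf.1 g hg.1 hf.2 hg.2 hfg hc).1 (Finset.card_le_one.1 hA _ hf.2 _ hg.2)
  · obtain ⟨I, hI, -, hle⟩ := h.opt J hJ hJc
    -- The sum is split into the fibres of `own`, each of which has the weight of its owner.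
    have h1 : ∑ f ∈ U with own f ∈ A, w₀ f = ∑ u ∈ A, w u := by
      rw [Finset.sum_congr rfl h.weight, ← Finset.sum_fiberwise_of_maps_to (t := A) (g := own)
        (s := U.filter fun f => own f ∈ A) (fun f hf => (Finset.mem_filter.1 hf).2)]
      refine Finset.sum_congr rfl fun u hu => ?_
      rw [Finset.filter_filter]
      refine Finset.sum_congr (Finset.filter_congr fun f _ => ?_) fun _ _ => rfl
      exact ⟨fun h => h.2, fun h => ⟨h ▸ hu, h⟩⟩
    rw [h1]
    exact hle.trans (Finset.sum_le_sum_of_subset_of_nonneg hI fun u hu _ => h.nonneg u hu)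

end Represents

end Cograph

/-! ### The program -/

namespace RAM

namespace State

variable (s : State)

@[simp] lemma setReg_arr (r : ℕ) (z : ℤ) : (s.setReg r z).arr = s.arr := rfl

@[simp] lemma setArr_reg (a : ℕ) (i z : ℤ) : (s.setArr a i z).reg = s.reg := rfl

lemma setReg_reg (r r' : ℕ) (z : ℤ) :
    (s.setReg r z).reg r' = if r' = r then z else s.reg r' := by
  simp [setReg, Function.update_apply]

lemma setArr_arr (a a' : ℕ) (i i' z : ℤ) :
    (s.setArr a i z).arr a' i' = if a' = a ∧ i' = i then z else s.arr a' i' := by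
  by_cases h : a' = a
  · subst h
    by_cases h' : i' = i
    · subst h'; simp [setArr]
    · simp [setArr, h']
  · simp [setArr, h]

end State

lemma Cmd.run_seq (n : ℕ) (p q : Cmd) (s : State) : (seq p q).run n s = q.run n (p.run n s) := rfl

lemma Cmd.run_assign (n r : ℕ) (e : Expr) (s : State) :
    (assign r e).run n s = s.setReg r (e.val s) := rfl

/-- Branching on equality. -/
def Cmd.ifEq (e f : Expr) (p q : Cmd) : Cmd := .cond (.sub e f) q (.cond (.sub f e) q p)

lemma Cmd.run_ifEq (n : ℕ) (e f : Expr) (p q : Cmd) (s : State) :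
    (ifEq e f p q).run n s = if e.val s = f.val s then p.run n s else q.run n s := by
  simp only [ifEq, run, Expr.val, sub_pos]
  rcases lt_trichotomy (e.val s) (f.val s) with h | h | h
  · simp [h, h.ne]
  · simp [h]
  · simp [h, h.ne']

end RAM

namespace MatchingProgram

open RAM Cograph

/-- The address of the entry `(e, f)` of a square matrix. -/
def entry (e f : Expr) : Expr := .add (.mul e .order) f

/-- The entry `(e, f)` of the adjacency matrix. -/
def adjacent (e f : Expr) : Expr := .read 0 (.add (.const 1) (entry e f))

/-- This is positive if an entry of the pair `e` is adjacent to an entry of the pair `f`. The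
entries of the pairs are in arrays `2` and `3`. -/
def conflicting (e f : Expr) : Expr :=
  .add (.add (adjacent (.read 2 e) (.read 2 f)) (adjacent (.read 2 e) (.read 3 f)))
    (.add (adjacent (.read 3 e) (.read 2 f)) (adjacent (.read 3 e) (.read 3 f)))

/-- Stores the pairs and their transposes in arrays `2`, `3`, and `8`. -/
def initPairs : Cmd :=
  .loop 1 1 (.loop 2 1 (.seq (.store 2 (entry (.reg 1) (.reg 2)) (.reg 1))
    (.seq (.store 3 (entry (.reg 1) (.reg 2)) (.reg 2))
      (.store 8 (entry (.reg 1) (.reg 2)) (entry (.reg 2) (.reg 1))))))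

/-- Multiplies register `3` by all denominators but the one of the pair in register `1`. -/
def clearDenominators : Cmd :=
  .loop 2 2 (.ifEq (.reg 1) (.reg 2) .skip (.assign 3 (.mul (.reg 3)
    (.read 0 (.add (.const 1) (.add (.add (.orderPow 2) (.orderPow 2)) (.reg 2)))))))

/-- Initializes the weight in array `4`, the owner in array `6`, and the mark in array `7` of the
pair in register `1`. -/
def initWeight : Cmd :=
  .seq (.assign 3 (.read 0 (.add (.const 1) (.add (.orderPow 2) (.reg 1)))))
    (.seq clearDenominators
      (.seq (.store 4 (.reg 1) (.reg 3))
        (.seq (.store 6 (.reg 1) (.reg 1)) (.cond (.reg 3) (.store 7 (.reg 1) (.const 1)) .skip))))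

/-- Initializes all weights, owners, and marks. The mark says that the pair is not eliminated. -/
def initWeights : Cmd := .loop 1 2 initWeight

/-- Sets register `4` to `1` if the pairs in the registers `2` and `3` are twins, and to `0`
otherwise. -/
def testTwins : Cmd :=
  .seq (.assign 4 (.const 1))
    (.loop 5 2 (.cond (.read 7 (.reg 5)) (.ifEq (.reg 5) (.reg 2) .skip
      (.ifEq (.reg 5) (.reg 3) .skip
      (.cond (conflicting (.reg 2) (.reg 5))
        (.cond (conflicting (.reg 3) (.reg 5)) .skip (.assign 4 (.const 0)))
        (.cond (conflicting (.reg 3) (.reg 5)) (.assign 4 (.const 0)) .skip)))) .skip))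

/-- Gives all pairs owned by the pair in register `3` to the pair in register `2`. -/
def relabel : Cmd :=
  .loop 5 2 (.ifEq (.read 6 (.reg 5)) (.reg 3) (.store 6 (.reg 5) (.reg 2)) .skip)

/-- Drops the lighter one of two conflicting twins, and merges non-conflicting twins. -/
def reduce : Cmd :=
  .cond (conflicting (.reg 2) (.reg 3))
    (.cond (.sub (.read 4 (.reg 3)) (.read 4 (.reg 2)))
      (.store 7 (.reg 2) (.const 0)) (.store 7 (.reg 3) (.const 0)))
    (.seq (.store 4 (.reg 2) (.add (.read 4 (.reg 2)) (.read 4 (.reg 3))))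
      (.seq relabel (.store 7 (.reg 3) (.const 0))))

/-- Eliminates one of the pairs in the registers `2` and `3` if they are twins. -/
def visit : Cmd :=
  .ifEq (.reg 2) (.reg 3) .skip (.cond (.read 7 (.reg 2)) (.cond (.read 7 (.reg 3))
    (.seq testTwins (.cond (.reg 4) reduce .skip)) .skip) .skip)

/-- Visits all pairs of pairs. -/
def sweep : Cmd := .loop 2 2 (.loop 3 2 visit)

/-- Writes the output. -/
def output : Cmd :=
  .seq (.loop 1 2 (.cond (.read 7 (.read 6 (.reg 1)))
      (.seq (.store 1 (.reg 1) (.const 1)) (.store 1 (.read 8 (.reg 1)) (.const 1))) .skip))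
    (.assign 0 (.orderPow 2))

/-- The whole program. -/
def main : Cmd := .seq initPairs (.seq initWeights (.seq (.loop 1 2 sweep) output))

lemma main_tame : main.tame = true := by decide

lemma zero_notMem_main_stores : 0 ∉ main.stores := by decide

/-! ### Correctness of the program: initialization. -/

section

variable (inp : ℤ → ℤ) (n : ℕ)

/-- The entry `(a, b)` of the adjacency matrix. -/
def adjVal (a b : ℤ) : ℤ := inp (1 + (a * n + b))

/-- The value of the expression `conflicting`. -/
def conflictVal (e f : ℤ) : ℤ :=
  adjVal inp n (e / n) (f / n) + adjVal inp n (e / n) (f % n) +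
    (adjVal inp n (e % n) (f / n) + adjVal inp n (e % n) (f % n))

/-- All pairs. -/
noncomputable def allPairs : Finset ℤ := Finset.Ico 0 ((n : ℤ) ^ 2)

/-- The conflict relation. -/
def Conflict (e f : ℤ) : Prop :=
  (e ∈ allPairs n ∧ f ∈ allPairs n) ∧ 0 < conflictVal inp n e f

/-- The weights, after the denominators are cleared. -/
def clearedWeight (e : ℤ) : ℤ :=
  inp (1 + ((n : ℤ) ^ 2 + e)) *
    ∏ f ∈ (Finset.range (n ^ 2)).filter (fun f : ℕ => (f : ℤ) ≠ e),
      inp (1 + ((n : ℤ) ^ 2 + (n : ℤ) ^ 2 + f))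

/-- The pairs of positive weight. -/
noncomputable def positivePairs : Finset ℤ := (allPairs n).filter fun e => 0 < clearedWeight inp n e

/-- The transpose of a pair. -/
def transpose (e : ℤ) : ℤ := e % n * n + e / n

variable {n} in
lemma mem_allPairs {e : ℤ} : e ∈ allPairs n ↔ 0 ≤ e ∧ e < (n : ℤ) ^ 2 := by simp [allPairs]

/-- The input is still there, and the pairs are in arrays `2`, `3` and `8`. -/
structure PairsReady (s : State) : Prop where
  input : s.arr 0 = inp
  fst : ∀ e ∈ allPairs n, s.arr 2 e = e / n
  snd : ∀ e ∈ allPairs n, s.arr 3 e = e % n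
  swap : ∀ e ∈ allPairs n, s.arr 8 e = transpose n e

variable {inp n}

lemma PairsReady.congr {s s' : State} (h : PairsReady inp n s) (h0 : s'.arr 0 = s.arr 0)
    (h2 : s'.arr 2 = s.arr 2) (h3 : s'.arr 3 = s.arr 3) (h8 : s'.arr 8 = s.arr 8) :
    PairsReady inp n s' :=
  ⟨h0.trans h.input, by rw [h2]; exact h.fst, by rw [h3]; exact h.snd, by rw [h8]; exact h.swap⟩

lemma order_val {s : State} (h0 : s.arr 0 = inp) (hn : inp 0 = n) : Expr.order.val s = n := by
  simp [Expr.order, Expr.val, h0, hn]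

lemma orderPow_two_val {s : State} (h0 : s.arr 0 = inp) (hn : inp 0 = n) :
    (Expr.orderPow 2).val s = (n : ℤ) ^ 2 := by
  simp [Expr.orderPow, Expr.val, order_val h0 hn, sq]

lemma conflicting_val (hn : inp 0 = n) {s : State} (h : PairsReady inp n s) {e f : Expr}
    (he : e.val s ∈ allPairs n) (hf : f.val s ∈ allPairs n) :
    (conflicting e f).val s = conflictVal inp n (e.val s) (f.val s) := by
  simp [conflicting, conflictVal, adjacent, adjVal, entry, Expr.val, h.fst _ he, h.fst _ hf,
    h.snd _ he, h.snd _ hf, order_val h.input hn, h.input]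

/-- The machine has no division, so quotients and remainders modulo `n` are tabulated by a double
loop in which they are the counters. -/
lemma initPairs_spec (hn : inp 0 = n) {s : State} (h0 : s.arr 0 = inp) :
    PairsReady inp n (initPairs.run n s) := by
  let P (k : ℤ) (s : State) : Prop := s.arr 0 = inp ∧ ∀ e, 0 ≤ e → e < k →
    s.arr 2 e = e / n ∧ s.arr 3 e = e % n ∧ s.arr 8 e = transpose n e
  have key : P ((n ^ 1 : ℕ) * n) (initPairs.run n s) := by
    refine Cmd.run_loop (fun j s => P (j * n) s) (by decide) ⟨h0, by
      intro e h1 h2; simp at h2; omega⟩ fun i hi s hs hP => ?_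
    have key2 := Cmd.run_loop (n := n) (r := 2) (k := 1) (s := s)
      (p := (.seq (.store 2 (entry (.reg 1) (.reg 2)) (.reg 1))
        (.seq (.store 3 (entry (.reg 1) (.reg 2)) (.reg 2))
          (.store 8 (entry (.reg 1) (.reg 2)) (entry (.reg 2) (.reg 1))))))
      (fun j s => s.reg 1 = i ∧ P (i * n + j) s) (by decide)
      ⟨by simpa [State.setReg_reg] using hs, by simpa [P] using hP⟩
      (fun j hj s hs2 ⟨hs1, hP⟩ => by
        rw [pow_one] at hj
        have hn0 : (0 : ℤ) < n := by omega
        have hd : ((i : ℤ) * n + j) / n = i := by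
          rw [add_comm, Int.add_mul_ediv_right _ _ hn0.ne', Int.ediv_eq_zero_of_lt] <;> omega
        have hm : ((i : ℤ) * n + j) % n = j := by
          rw [add_comm, Int.add_mul_emod_self_right, Int.emod_eq_of_lt] <;> omega
        refine ⟨by simpa [Cmd.run, State.setReg_reg] using hs1, ?_, ?_⟩
        · simpa [Cmd.run, State.setArr, Function.update_apply] using hP.1
        · intro e he1 he2
          have h2 : Expr.order.val s = n := order_val hP.1 hn
          have h4 : ∀ a i z, a ≠ 0 → Expr.order.val (s.setArr a i z) = n := fun a i z ha =>
            order_val (by simpa [State.setArr, Function.update_apply, ha.symm] using hP.1) hn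
          have h5 : ∀ a i z a' i' z', a ≠ 0 → a' ≠ 0 →
              Expr.order.val ((s.setArr a i z).setArr a' i' z') = n := fun a i z a' i' z' ha ha' =>
            order_val (by
              simpa [State.setArr, Function.update_apply, ha.symm, ha'.symm] using hP.1) hn
          simp only [Cmd.run, entry, Expr.val, State.setArr_reg, hs1, hs2, State.setReg_arr,
            State.setArr_arr, h2, h4 2 _ _ (by decide), h5 2 _ _ 3 _ _ (by decide) (by decide)]
          by_cases he : e = i * n + j
          · simp [he, transpose, hd, hm]
          · simpa [he] using hP.2 e he1 (by omega))
    have := key2.2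
    simp only [pow_one] at this
    simpa [P, add_mul, add_comm] using this
  refine ⟨key.1, fun e he => ?_, fun e he => ?_, fun e he => ?_⟩ <;>
  · rw [mem_allPairs, sq] at he
    have := key.2 e he.1 (by simpa using he.2)
    simp [this]

/-- Omitting the pair's own denominator turns its numerator into the weight times the product of all
denominators, again without a division. -/
lemma clearDenominators_spec (hn : inp 0 = n) {s : State} (h0 : s.arr 0 = inp) :
    (clearDenominators.run n s).reg 3 = s.reg 3 *
      ∏ f ∈ (Finset.range (n ^ 2)).filter (fun f : ℕ => (f : ℤ) ≠ s.reg 1),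
        inp (1 + ((n : ℤ) ^ 2 + (n : ℤ) ^ 2 + f)) := by
  refine (Cmd.run_loop (fun j s' => s'.reg 1 = s.reg 1 ∧ s'.arr 0 = inp ∧ s'.reg 3 = s.reg 3 *
      ∏ f ∈ (Finset.range j).filter (fun f : ℕ => (f : ℤ) ≠ s.reg 1),
        inp (1 + ((n : ℤ) ^ 2 + (n : ℤ) ^ 2 + f))) (by decide)
      ⟨by simp [State.setReg_reg], by simpa using h0, by simp [State.setReg_reg]⟩
      fun j hj s' hs' ⟨h1, h2, h3⟩ => ?_).2.2
  simp only [Cmd.run_ifEq, Expr.val, h1, hs', Finset.range_add_one, Finset.filter_insert]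
  by_cases h : s.reg 1 = j
  · simp [h, Cmd.run, State.setReg_reg, h1, h2, h3]
  · rw [if_neg h, if_pos (fun h' => h h'.symm), Finset.prod_insert (by simp)]
    simp [Cmd.run, State.setReg_reg, h1, h2, h3, Expr.val, orderPow_two_val h2 hn, hs']
    ring

/-- The pairs that are not eliminated. -/
noncomputable def alive (n : ℕ) (s : State) : Finset ℤ := (allPairs n).filter fun e => 0 < s.arr 7 e

variable (inp n) in
/-- The invariant of the elimination. -/
structure Invariant (s : State) : Prop where
  ready : PairsReady inp n s
  -- The output reads marks at the addresses of owners; this guarantees that a positive mark found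
  -- there belongs to a pair.
  outside : ∀ e, 0 < s.arr 7 e → e ∈ allPairs n
  represents : Represents (Conflict inp n) (allPairs n) (positivePairs inp n) (clearedWeight inp n)
    (alive n s) (s.arr 4) (s.arr 6)

lemma Invariant.congr {s s' : State} (h : Invariant inp n s) (ha : s'.arr = s.arr) :
    Invariant inp n s' := by
  refine ⟨h.ready.congr ?_ ?_ ?_ ?_, ?_, ?_⟩ <;> (try unfold alive) <;> rw [ha]
  exacts [h.outside, h.represents]

lemma initWeight_arr (hn : inp 0 = n) {s : State} {j : ℕ} (h0 : s.arr 0 = inp) (hs : s.reg 1 = j)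
    (a : ℕ) (i : ℤ) : (initWeight.run n s).arr a i =
      if a = 7 ∧ i = j ∧ 0 < clearedWeight inp n j then 1
      else if a = 6 ∧ i = j then (j : ℤ)
      else if a = 4 ∧ i = j then clearedWeight inp n j else s.arr a i := by
  simp only [initWeight, Cmd.run_seq, Cmd.run_assign]
  generalize hs1 : s.setReg 3 _ = s1
  have e1 : s1.reg 1 = j := by simp [← hs1, State.setReg_reg, hs]
  have e0 : s1.arr = s.arr := by rw [← hs1]; rfl
  have e3 : s1.reg 3 = inp (1 + ((n : ℤ) ^ 2 + j)) := by
    simp [← hs1, State.setReg_reg, Expr.val, h0, orderPow_two_val h0 hn, hs]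
  generalize hs2 : clearDenominators.run n s1 = s2
  have f3 : s2.reg 3 = clearedWeight inp n j := by
    rw [← hs2, clearDenominators_spec hn (by rw [e0, h0]), e3, e1, clearedWeight]
  have f1 : s2.reg 1 = j := by rw [← hs2, Cmd.run_reg _ _ _ (by decide), e1]
  have fa : s2.arr a = s.arr a := by
    rw [← hs2, Cmd.run_arr _ _ _ (by simp [clearDenominators, Cmd.stores, Cmd.ifEq]), e0]
  simp only [Cmd.run, Expr.val, State.setArr_reg, f3, f1]
  by_cases hw : 0 < clearedWeight inp n j
  · simp [hw, State.setArr_arr, fa]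
  · simp [hw, State.setArr_arr, fa]

lemma initWeights_spec (hn : inp 0 = n) {s : State} (h : PairsReady inp n s)
    (h7 : ∀ e, s.arr 7 e = 0) : Invariant inp n (initWeights.run n s) := by
  have key := Cmd.run_loop (n := n) (s := s) (fun j s => s.arr 0 = inp ∧
      (∀ e : ℤ, 0 ≤ e → e < j → s.arr 4 e = clearedWeight inp n e ∧ s.arr 6 e = e ∧
        (0 < s.arr 7 e ↔ 0 < clearedWeight inp n e)) ∧
      -- A mark is written only for positive weight, so the others rely on the initial value `0`.
      ∀ e : ℤ, (e < 0 ∨ j ≤ e) → s.arr 7 e = 0) (r := 1) (k := 2) (p := initWeight)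
    (by decide) ⟨by simpa using h.input, by intro e h1 h2; simp at h2; omega,
      fun e _ => h7 e⟩
    (fun j hj s hs ⟨h0, h1, h2⟩ => by
      refine ⟨?_, fun e he1 he2 => ?_, fun e he => ?_⟩
      · rw [State.setReg_arr, Cmd.run_arr _ _ _ (by decide), h0]
      · simp only [State.setReg_arr, initWeight_arr hn h0 hs]
        by_cases he : e = j
        · subst he
          have := h2 j (.inr le_rfl)
          by_cases hw : 0 < clearedWeight inp n j <;> simp [hw, this]
        · simpa [he] using h1 e he1 (by push_cast at he2; omega)
      · simp only [State.setReg_arr, initWeight_arr hn h0 hs]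
        have hne : e ≠ j := by push_cast at he; omega
        simpa [hne] using h2 e (by push_cast at he; omega))
  obtain ⟨h0, h1, h2⟩ := key
  change ∀ e : ℤ, _ → _ → (initWeights.run n s).arr 4 e = _ ∧ (initWeights.run n s).arr 6 e = _ ∧
    (0 < (initWeights.run n s).arr 7 e ↔ _) at h1
  change ∀ e : ℤ, _ → (initWeights.run n s).arr 7 e = 0 at h2
  push_cast at h1 h2
  have ha : alive n (initWeights.run n s) = positivePairs inp n := by
    refine Finset.filter_congr fun e he => ?_
    rw [mem_allPairs] at he
    exact (h1 e he.1 he.2).2.2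
  refine ⟨h.congr (Cmd.run_arr _ _ _ (by decide)) (Cmd.run_arr _ _ _ (by decide))
    (Cmd.run_arr _ _ _ (by decide)) (Cmd.run_arr _ _ _ (by decide)), fun e he => ?_, ?_⟩
  · by_contra hcon
    rw [mem_allPairs] at hcon
    rw [h2 e (by omega)] at he
    omega
  · rw [ha]
    refine .refl (Finset.filter_subset _ _) (fun u hu => ?_) (fun f hf => ?_) (fun u hu => ?_)
    · exact (Finset.mem_filter.1 hu).2.le
    · rw [mem_allPairs] at hf
      exact (h1 f hf.1 hf.2).2.1
    · have := mem_allPairs.1 (Finset.mem_filter.1 hu).1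
      exact (h1 u this.1 this.2).1

/-! ### Correctness of the program: elimination of twins and output. -/

variable (hn : inp 0 = n) {s : State}

include hn in
lemma testTwins_spec (h : PairsReady inp n s) (hu : s.reg 2 ∈ allPairs n)
    (hv : s.reg 3 ∈ allPairs n) :
    0 < (testTwins.run n s).reg 4 ↔ Twins (Conflict inp n) (alive n s) (s.reg 2) (s.reg 3) := by
  have key := Cmd.run_loop (n := n) (s := s.setReg 4 1) (r := 5) (k := 2)
    (p := (.cond (.read 7 (.reg 5)) (.ifEq (.reg 5) (.reg 2) .skip
      (.ifEq (.reg 5) (.reg 3) .skip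
      (.cond (conflicting (.reg 2) (.reg 5))
        (.cond (conflicting (.reg 3) (.reg 5)) .skip (.assign 4 (.const 0)))
        (.cond (conflicting (.reg 3) (.reg 5)) (.assign 4 (.const 0)) .skip)))) .skip))
    (fun j s' => s'.arr = s.arr ∧ s'.reg 2 = s.reg 2 ∧ s'.reg 3 = s.reg 3 ∧
      (0 < s'.reg 4 ↔ ∀ x : ℤ, 0 ≤ x → x < j → 0 < s.arr 7 x → x ≠ s.reg 2 → x ≠ s.reg 3 →
        (Conflict inp n (s.reg 2) x ↔ Conflict inp n (s.reg 3) x)))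
    (by decide)
    ⟨rfl, by simp [State.setReg_reg], by simp [State.setReg_reg], by
      simp only [State.setReg_reg]
      norm_num
      intro x h1 h2
      omega⟩
    (fun j hj s' hs' ⟨ha, h2, h3, h4⟩ => by
      have hr : PairsReady inp n s' := h.congr (by rw [ha]) (by rw [ha]) (by rw [ha]) (by rw [ha])
      have hjm : (j : ℤ) ∈ allPairs n := mem_allPairs.2 ⟨by omega, by exact_mod_cast hj⟩
      have e2 : (conflicting (.reg 2) (.reg 5)).val s' = conflictVal inp n (s.reg 2) j := by
        rw [conflicting_val hn hr] <;> simp only [Expr.val, h2, hs', hjm, hu]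
      have e3 : (conflicting (.reg 3) (.reg 5)).val s' = conflictVal inp n (s.reg 3) j := by
        rw [conflicting_val hn hr] <;> simp only [Expr.val, h3, hs', hjm, hv]
      have hsplit : (∀ x : ℤ, 0 ≤ x → x < (j + 1 : ℕ) → 0 < s.arr 7 x → x ≠ s.reg 2 → x ≠ s.reg 3 →
          (Conflict inp n (s.reg 2) x ↔ Conflict inp n (s.reg 3) x)) ↔
          (0 < s'.reg 4 ∧ (0 < s.arr 7 j → (j : ℤ) ≠ s.reg 2 → (j : ℤ) ≠ s.reg 3 →
          (Conflict inp n (s.reg 2) j ↔ Conflict inp n (s.reg 3) j))) := by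
        rw [h4]
        refine ⟨fun H => ⟨fun x h1 h2 => H x h1 (by push_cast; omega),
          H j (by omega) (by push_cast; omega)⟩, fun H x h1 h2 => ?_⟩
        rcases eq_or_ne x j with rfl | hx
        exacts [H.2, H.1 x h1 (by push_cast at h2; omega)]
      rw [hsplit]
      simp only [Cmd.run, Cmd.run_ifEq, e2, e3]
      simp only [Expr.val, hs', h2, h3, ha, Conflict, hu, hv, hjm, true_and]
      clear hsplit
      split_ifs <;> simp_all [State.setReg_reg]; (intros; omega))
  refine (key.2.2.2).trans ?_
  push_cast
  simp only [Twins, alive, Finset.mem_filter, mem_allPairs]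
  exact ⟨fun H x hx => H x hx.1.1 hx.1.2 hx.2, fun H x h1 h2 h3 => H x ⟨⟨h1, h2⟩, h3⟩⟩

lemma testTwins_arr : (testTwins.run n s).arr = s.arr :=
  funext fun _ => Cmd.run_arr _ _ _ (by simp [testTwins, Cmd.stores, Cmd.ifEq])

lemma relabel_arr {f : ℤ} (hf : f ∈ allPairs n) :
    (relabel.run n s).arr 6 f = if s.arr 6 f = s.reg 3 then s.reg 2 else s.arr 6 f := by
  have key := Cmd.run_loop (n := n) (s := s) (r := 5) (k := 2)
    (p := (.ifEq (.read 6 (.reg 5)) (.reg 3) (.store 6 (.reg 5) (.reg 2)) .skip))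
    (fun j s' => s'.reg 2 = s.reg 2 ∧ s'.reg 3 = s.reg 3 ∧ ∀ f : ℤ, s'.arr 6 f =
      if (0 ≤ f ∧ f < j) ∧ s.arr 6 f = s.reg 3 then s.reg 2 else s.arr 6 f)
    (by decide)
    ⟨by simp [State.setReg_reg], by simp [State.setReg_reg], fun f => by
      rw [if_neg]
      · rfl
      · rintro ⟨h, -⟩
        push_cast at h
        omega⟩
    (fun j hj s' hs' ⟨h2, h3, h6⟩ => by
      have hj6 : s'.arr 6 j = s.arr 6 j := by
        rw [h6, if_neg]
        omega
      simp only [Cmd.run_ifEq, Expr.val, hs', hj6, h3, Cmd.run, h2]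
      refine ⟨?_, ?_, fun f => ?_⟩
      · split_ifs <;> simp [State.setReg_reg, h2]
      · split_ifs <;> simp [State.setReg_reg, h3]
      · rcases eq_or_ne f j with rfl | hf
        · split_ifs <;> simp_all [State.setArr_arr]
        · have : (0 ≤ f ∧ f < (j + 1 : ℕ)) ↔ (0 ≤ f ∧ f < j) := by push_cast; omega
          simp only [this]
          rw [← h6]
          split_ifs <;> simp [State.setArr_arr, hf])
  have := key.2.2 f
  rw [mem_allPairs] at hf
  push_cast at this
  unfold relabel
  simpa [hf] using this

lemma alive_store {s s' : State} {v : ℤ} (h : ∀ e, s'.arr 7 e = if e = v then 0 else s.arr 7 e) :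
    alive n s' = (alive n s).erase v := by
  ext e
  simp only [alive, Finset.mem_filter, Finset.mem_erase, h]
  split_ifs with he <;> simp [he]

lemma Invariant.of_erase (h : Invariant inp n s) {s' : State}
    (ha : ∀ a ∈ [0, 2, 3, 8], s'.arr a = s.arr a) {v : ℤ} (h7 : ∀ e, s'.arr 7 e = if e = v then 0 else s.arr 7 e)
    (hr : Represents (Conflict inp n) (allPairs n) (positivePairs inp n) (clearedWeight inp n)
      ((alive n s).erase v) (s'.arr 4) (s'.arr 6)) : Invariant inp n s' where
  ready := h.ready.congr (ha 0 (by simp)) (ha 2 (by simp)) (ha 3 (by simp)) (ha 8 (by simp))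
  outside e he := by
    rw [h7] at he
    split_ifs at he
    · omega
    · exact h.outside e he
  represents := by rwa [alive_store h7]

variable (hs : ∀ ⦃e f⦄, Conflict inp n e f → Conflict inp n f e)

include hn hs in
lemma reduce_spec (h : Invariant inp n s) (hu : s.reg 2 ∈ alive n s) (hv : s.reg 3 ∈ alive n s)
    (huv : s.reg 2 ≠ s.reg 3) (ht : Twins (Conflict inp n) (alive n s) (s.reg 2) (s.reg 3)) :
    Invariant inp n (reduce.run n s) ∧ ∃ d, (d = s.reg 2 ∨ d = s.reg 3) ∧
      alive n (reduce.run n s) = (alive n s).erase d := by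
  have hu' := (Finset.mem_filter.1 hu).1
  have hv' := (Finset.mem_filter.1 hv).1
  have hc : (conflicting (.reg 2) (.reg 3)).val s = conflictVal inp n (s.reg 2) (s.reg 3) :=
    conflicting_val hn h.ready hu' hv'
  rw [reduce, Cmd.run, hc]
  split_ifs with hcon
  · replace hcon : Conflict inp n (s.reg 2) (s.reg 3) := ⟨⟨hu', hv'⟩, hcon⟩
    rw [Cmd.run]
    simp only [Expr.val, sub_pos]
    split_ifs with hw
    · have h7 : ∀ e, ((Cmd.store 7 (.reg 2) (.const 0)).run n s).arr 7 e =
          if e = s.reg 2 then 0 else s.arr 7 e := fun e => by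
        simp [Cmd.run, State.setArr_arr, Expr.val]
      refine ⟨h.of_erase (fun a ha => Cmd.run_arr _ _ _ ?_) h7 ?_, _, .inl rfl, alive_store h7⟩
      · rintro h7; simp [Cmd.stores] at h7; simp [h7] at ha
      · exact h.represents.erase hs hv huv.symm (fun x hx h1 h2 => (ht x hx h2 h1).symm) (hs hcon)
          hw.le
    · have h7 : ∀ e, ((Cmd.store 7 (.reg 3) (.const 0)).run n s).arr 7 e =
          if e = s.reg 3 then 0 else s.arr 7 e := fun e => by
        simp [Cmd.run, State.setArr_arr, Expr.val]
      refine ⟨h.of_erase (fun a ha => Cmd.run_arr _ _ _ ?_) h7 ?_, _, .inr rfl, alive_store h7⟩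
      · rintro h7; simp [Cmd.stores] at h7; simp [h7] at ha
      · exact h.represents.erase hs hu huv ht hcon (not_lt.1 hw)
  · replace hcon : ¬ Conflict inp n (s.reg 2) (s.reg 3) := fun h0 => hcon h0.2
    have hset : ∀ a, a ≠ 4 → (s.setArr 4 (s.reg 2) (s.arr 4 (s.reg 2) + s.arr 4 (s.reg 3))).arr a
        = s.arr a := fun a ha => by
      funext i; simp [State.setArr_arr, ha]
    simp only [Cmd.run_seq]
    change Invariant inp n (Cmd.run n (.store 7 (.reg 3) (.const 0)) (relabel.run n
      (s.setArr 4 (s.reg 2) (s.arr 4 (s.reg 2) + s.arr 4 (s.reg 3))))) ∧ ∃ d, _ ∧ alive n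
      (Cmd.run n (.store 7 (.reg 3) (.const 0)) (relabel.run n
      (s.setArr 4 (s.reg 2) (s.arr 4 (s.reg 2) + s.arr 4 (s.reg 3))))) = _
    generalize hs1 : s.setArr 4 (s.reg 2) (s.arr 4 (s.reg 2) + s.arr 4 (s.reg 3)) = s1 at *
    have hreg : s1.reg = s.reg := by rw [← hs1]; rfl
    have h4 : ∀ e, s1.arr 4 e = if e = s.reg 2 then s.arr 4 (s.reg 2) + s.arr 4 (s.reg 3)
        else s.arr 4 e := fun e => by rw [← hs1]; simp [State.setArr_arr]
    have hrel : ∀ f ∈ allPairs n, (relabel.run n s1).arr 6 f =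
        if s.arr 6 f = s.reg 3 then s.reg 2 else s.arr 6 f := fun f hf => by
      rw [relabel_arr hf, hreg, hset 6 (by decide)]
    have hreg3 : (relabel.run n s1).reg 3 = s.reg 3 := by
      rw [Cmd.run_reg _ _ _ (by decide), hreg]
    have hrela : ∀ a, a ≠ 6 → (relabel.run n s1).arr a = s1.arr a := fun a ha =>
      Cmd.run_arr _ _ _ (by simpa [relabel, Cmd.stores, Cmd.ifEq] using ha)
    generalize relabel.run n s1 = s2 at *
    have h7 : ∀ e, ((Cmd.store 7 (.reg 3) (.const 0)).run n s2).arr 7 e =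
        if e = s.reg 3 then 0 else s.arr 7 e := fun e => by
      simp [Cmd.run, State.setArr_arr, Expr.val, hreg3, hrela 7, hset 7]
    have ha : ∀ a, a ≠ 7 → ((Cmd.store 7 (.reg 3) (.const 0)).run n s2).arr a = s2.arr a :=
      fun a ha => Cmd.run_arr _ _ _ (by simpa [Cmd.stores] using ha)
    refine ⟨h.of_erase (fun a ha' => ?_) h7 ?_, _, .inr rfl, alive_store h7⟩
    · have : a ≠ 7 ∧ a ≠ 6 ∧ a ≠ 4 := by
        refine ⟨?_, ?_, ?_⟩ <;> rintro rfl <;> simp at ha'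
      rw [ha a this.1, hrela a this.2.1, hset a this.2.2]
    · refine h.represents.merge hs hu hv huv ht hcon ?_ (fun x hx hxu => ?_) (fun f hf => ?_)
      · rw [ha 4 (by decide), hrela 4 (by decide), h4, if_pos rfl]
      · rw [ha 4 (by decide), hrela 4 (by decide), h4, if_neg hxu]
      · rw [ha 6 (by decide), hrel f hf]

-- The last clause makes progress measurable: if the two visited pairs are distinct live twins,
-- `reduce` eliminates one of them, so they cannot both survive.
include hn hs in
lemma visit_spec (h : Invariant inp n s) (hu : s.reg 2 ∈ allPairs n) (hv : s.reg 3 ∈ allPairs n) :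
    Invariant inp n (visit.run n s) ∧ alive n (visit.run n s) ⊆ alive n s ∧
      (s.reg 2 ≠ s.reg 3 → s.reg 2 ∈ alive n (visit.run n s) → s.reg 3 ∈ alive n (visit.run n s) →
        ¬ Twins (Conflict inp n) (alive n s) (s.reg 2) (s.reg 3)) := by
  rw [visit, Cmd.run_ifEq]
  split_ifs with huv
  · exact ⟨h, subset_rfl, fun h => absurd huv h⟩
  rw [Cmd.run]
  split_ifs with h1
  swap
  · exact ⟨h, subset_rfl, fun _ h2 => absurd (Finset.mem_filter.1 h2).2 h1⟩
  rw [Cmd.run]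
  split_ifs with h2
  swap
  · exact ⟨h, subset_rfl, fun _ _ h3 => absurd (Finset.mem_filter.1 h3).2 h2⟩
  have htest := testTwins_spec hn h.ready hu hv
  have harr : (testTwins.run n s).arr = s.arr := testTwins_arr
  have hr2 : (testTwins.run n s).reg 2 = s.reg 2 := Cmd.run_reg _ _ _ (by decide)
  have hr3 : (testTwins.run n s).reg 3 = s.reg 3 := Cmd.run_reg _ _ _ (by decide)
  rw [Cmd.run_seq]
  generalize testTwins.run n s = s1 at *
  have halive : alive n s1 = alive n s := by simp [alive, harr]
  have hinv : Invariant inp n s1 := h.congr harr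
  rw [Cmd.run]
  split_ifs with h4
  · have hu' : s.reg 2 ∈ alive n s := Finset.mem_filter.2 ⟨hu, h1⟩
    have hv' : s.reg 3 ∈ alive n s := Finset.mem_filter.2 ⟨hv, h2⟩
    obtain ⟨hinv', d, hd, hal⟩ := reduce_spec hn hs hinv (by rwa [hr2, halive])
      (by rwa [hr3, halive]) (by rwa [hr2, hr3]) (by rw [hr2, hr3, halive]; exact htest.1 h4)
    rw [hal, halive]
    refine ⟨hinv', Finset.erase_subset _ _, fun _ h5 h6 => ?_⟩
    rw [hr2, hr3] at hd
    rcases hd with rfl | rfl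
    · exact absurd rfl (Finset.ne_of_mem_erase h5)
    · exact absurd rfl (Finset.ne_of_mem_erase h6)
  · exact ⟨hinv, halive.subset, fun _ _ _ ht => h4 (htest.2 ht)⟩

-- Elimination only shrinks the set of live pairs, and twins in a set remain twins in every subset.
-- So twins at the start of a sweep are still twins when they are visited, unless one of them has
-- gone already.
include hn hs in
lemma sweep_spec (h : Invariant inp n s) :
    Invariant inp n (sweep.run n s) ∧ alive n (sweep.run n s) ⊆ alive n s ∧
      ∀ u ∈ alive n (sweep.run n s), ∀ v ∈ alive n (sweep.run n s), u ≠ v →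
        ¬ Twins (Conflict inp n) (alive n s) u v := by
  let P (Q : ℤ → ℤ → Prop) (s' : State) : Prop := Invariant inp n s' ∧ alive n s' ⊆ alive n s ∧
    ∀ u ∈ alive n s', ∀ v ∈ alive n s', u ≠ v → Q u v → ¬ Twins (Conflict inp n) (alive n s) u v
  have key : P (fun u _ => u < (n ^ 2 : ℕ)) (sweep.run n s) := by
    refine Cmd.run_loop (fun i => P (fun u _ => u < i)) (by decide)
      ⟨h.congr rfl, subset_rfl, fun u hu _ _ _ h0 => ?_⟩
      fun i hi s1 hs1 hP => ?_
    · have := (mem_allPairs.1 (Finset.mem_filter.1 hu).1).1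
      push_cast at h0
      omega
    have key2 := Cmd.run_loop (n := n) (r := 3) (k := 2) (s := s1) (p := visit)
      -- The pairs visited so far are those that lexicographically precede `(i, j)`.
      (fun j s' => s'.reg 2 = i ∧ P (fun u v => u < i ∨ u = i ∧ v < j) s') (by decide)
      ⟨by simpa [State.setReg_reg] using hs1, hP.1.congr rfl, hP.2.1,
        fun u hu v hv huv hlt => hP.2.2 u hu v hv huv (hlt.resolve_right fun h0 => by
          have := (mem_allPairs.1 (Finset.mem_filter.1 hv).1).1
          push_cast at h0
          omega)⟩
      (fun j hj s2 hs2 ⟨hs2', hP⟩ => by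
        have hu : s2.reg 2 ∈ allPairs n := by
          rw [hs2', mem_allPairs]; exact ⟨by omega, by exact_mod_cast hi⟩
        have hv : s2.reg 3 ∈ allPairs n := by
          rw [hs2, mem_allPairs]; exact ⟨by omega, by exact_mod_cast hj⟩
        obtain ⟨h1, h2, h3⟩ := visit_spec hn hs hP.1 hu hv
        have hreg : (visit.run n s2).reg 2 = s2.reg 2 := Cmd.run_reg _ _ _ (by decide)
        refine ⟨by simpa [State.setReg_reg, hreg] using hs2', h1.congr rfl,
          h2.trans hP.2.1, fun u hu v hv huv hlt ht => ?_⟩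
        change u ∈ alive n (visit.run n s2) at hu
        change v ∈ alive n (visit.run n s2) at hv
        by_cases hlt' : u < i ∨ u = i ∧ v < j
        · exact hP.2.2 u (h2 hu) v (h2 hv) huv hlt' ht
        · obtain ⟨rfl, rfl⟩ : u = s2.reg 2 ∧ v = s2.reg 3 := by push_cast at hlt; omega
          exact h3 huv hu hv fun x hx => ht x (hP.2.1 hx))
    refine ⟨key2.2.1.congr rfl, key2.2.2.1,
      fun u hu v hv huv hlt => key2.2.2.2 u hu v hv huv ?_⟩
    have := (mem_allPairs.1 (Finset.mem_filter.1 hv).1).2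
    push_cast at hlt ⊢
    omega
  exact ⟨key.1, key.2.1, fun u hu v hv huv => key.2.2 u hu v hv huv (by
    exact_mod_cast (mem_allPairs.1 (Finset.mem_filter.1 hu).1).2)⟩

include hn hs in
lemma sweeps_spec (hc : IsCographOn (Conflict inp n) (positivePairs inp n))
    (h : Invariant inp n s) : Invariant inp n ((Cmd.loop 1 2 sweep).run n s) ∧
      (alive n ((Cmd.loop 1 2 sweep).run n s)).card ≤ 1 := by
  have hcard : (alive n s).card ≤ n ^ 2 := by
    refine (Finset.card_le_card (Finset.filter_subset _ _)).trans ?_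
    rw [allPairs, Int.card_Ico]
    simp
  have key := Cmd.run_loop (n := n) (r := 1) (k := 2) (p := sweep) (s := s)
    -- While two pairs are alive, the cograph property yields twins and each sweep eliminates at
    -- least one pair; `n ^ 2` sweeps therefore suffice.
    (fun j s => Invariant inp n s ∧ ((alive n s).card ≤ 1 ∨ (alive n s).card + j ≤ n ^ 2))
    (by decide) ⟨h.congr rfl, .inr hcard⟩
    (fun j hj s _ ⟨hinv, hle⟩ => by
      obtain ⟨h1, h2, h3⟩ := sweep_spec hn hs hinv
      refine ⟨h1.congr rfl, ?_⟩
      change (alive n (sweep.run n s)).card ≤ 1 ∨ (alive n (sweep.run n s)).card + (j + 1) ≤ n ^ 2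
      by_cases hA : 2 ≤ (alive n s).card
      · obtain ⟨u, hu, v, hv, huv, ht⟩ := (hc.subset hinv.represents.subset).exists_twins hA
        have := Finset.card_lt_card (Finset.ssubset_iff_subset_ne.2 ⟨h2, fun heq =>
          h3 u (heq ▸ hu) v (heq ▸ hv) huv ht⟩)
        omega
      · exact .inl ((Finset.card_le_card h2).trans (by omega)))
  exact ⟨key.1, by omega⟩

include hn in
lemma output_spec (h : Invariant inp n s) (h1 : ∀ k, s.arr 1 k = 0) :
    (output.run n s).reg 0 = (n : ℤ) ^ 2 ∧ ∀ k, (output.run n s).arr 1 k =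
      if ∃ e ∈ allPairs n, s.arr 6 e ∈ alive n s ∧ (k = e ∨ k = transpose n e) then 1 else 0 := by
  classical
  have key := Cmd.run_loop (n := n) (r := 1) (k := 2) (s := s)
    (p := .cond (.read 7 (.read 6 (.reg 1)))
      (.seq (.store 1 (.reg 1) (.const 1)) (.store 1 (.read 8 (.reg 1)) (.const 1))) .skip)
    (fun j s' => (∀ a, a ≠ 1 → s'.arr a = s.arr a) ∧ ∀ k, s'.arr 1 k =
      if ∃ e : ℤ, (0 ≤ e ∧ e < j) ∧ s.arr 6 e ∈ alive n s ∧ (k = e ∨ k = transpose n e) then 1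
      else 0)
    (by decide) ⟨fun a _ => rfl, fun k => by
      rw [if_neg]
      · exact h1 k
      · rintro ⟨e, h0, -⟩
        push_cast at h0
        omega⟩
    (fun j hj s' hs' ⟨ha, hk⟩ => by
      have hj' : (j : ℤ) ∈ allPairs n := mem_allPairs.2 ⟨by omega, by exact_mod_cast hj⟩
      have hal : 0 < s.arr 7 (s.arr 6 j) ↔ s.arr 6 j ∈ alive n s :=
        ⟨fun h0 => Finset.mem_filter.2 ⟨h.outside _ h0, h0⟩, fun h0 => (Finset.mem_filter.1 h0).2⟩
      refine ⟨fun a h0 => ?_, fun k => ?_⟩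
      · rw [State.setReg_arr, Cmd.run_arr _ _ _ (by simpa [Cmd.stores] using h0), ha a h0]
      have hsplit : (∃ e : ℤ, (0 ≤ e ∧ e < (j + 1 : ℕ)) ∧ s.arr 6 e ∈ alive n s ∧
          (k = e ∨ k = transpose n e)) ↔ (∃ e : ℤ, (0 ≤ e ∧ e < j) ∧ s.arr 6 e ∈ alive n s ∧
          (k = e ∨ k = transpose n e)) ∨ (s.arr 6 j ∈ alive n s ∧ (k = j ∨ k = transpose n j)) := by
        constructor
        · rintro ⟨e, h2, h3⟩
          rcases eq_or_ne e j with rfl | he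
          · exact .inr h3
          · exact .inl ⟨e, by push_cast at h2; omega, h3⟩
        · rintro (⟨e, h2, h3⟩ | h3)
          · exact ⟨e, by push_cast; omega, h3⟩
          · exact ⟨j, by push_cast; omega, h3⟩
      simp only [hsplit]
      have h7 : 0 < (Expr.read 7 (.read 6 (.reg 1))).val s' ↔ s.arr 6 j ∈ alive n s := by
        rw [← hal]
        simp [Expr.val, ha, hs']
      rw [State.setReg_arr, Cmd.run]
      by_cases hm : s.arr 6 j ∈ alive n s
      · rw [if_pos (h7.2 hm)]
        simp only [Cmd.run, Expr.val, State.setArr_reg, hs', State.setArr_arr, hk]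
        rw [ha 8 (by decide), h.ready.swap _ hj']
        simp only [hm, true_and, show ¬ (8 = 1) by decide, false_and, if_false]
        by_cases c1 : k = transpose n j <;> by_cases c2 : k = j <;> simp [c1, c2]
      · rw [if_neg (fun h0 => hm (h7.1 h0))]
        simp only [Cmd.run, hk, hm, false_and, or_false])
  have hin : ((Cmd.loop 1 2 (.cond (.read 7 (.read 6 (.reg 1)))
      (.seq (.store 1 (.reg 1) (.const 1)) (.store 1 (.read 8 (.reg 1)) (.const 1)))
      .skip)).run n s).arr 0 = inp := by rw [key.1 0 (by decide), h.ready.input]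
  rw [output, Cmd.run_seq, Cmd.run_assign, orderPow_two_val hin hn]
  refine ⟨by simp [State.setReg_reg], fun k => ?_⟩
  rw [State.setReg_arr, key.2 k]
  simp only [mem_allPairs, Nat.cast_pow]

/-- The program determines a maximum weight independent set, if the conflict graph is a cograph. -/
theorem main_spec {s : State} (hn : s.arr 0 0 = n)
    (hs : ∀ ⦃e f⦄, Conflict (s.arr 0) n e f → Conflict (s.arr 0) n f e)
    (hc : IsCographOn (Conflict (s.arr 0) n) (positivePairs (s.arr 0) n))
    (h1 : ∀ k, s.arr 1 k = 0) (h7 : ∀ k, s.arr 7 k = 0) :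
    (main.run n s).reg 0 = (n : ℤ) ^ 2 ∧ ∃ S ⊆ positivePairs (s.arr 0) n,
      Indep (Conflict (s.arr 0) n) S ∧
      (∀ J ⊆ positivePairs (s.arr 0) n, Indep (Conflict (s.arr 0) n) J →
        ∑ e ∈ J, clearedWeight (s.arr 0) n e ≤ ∑ e ∈ S, clearedWeight (s.arr 0) n e) ∧
      ∀ k, (main.run n s).arr 1 k = if ∃ e ∈ S, k = e ∨ k = transpose n e then 1 else 0 := by
  have hpairs := initPairs_spec hn (s := s) rfl
  have hpairs7 : (initPairs.run n s).arr 7 = s.arr 7 := Cmd.run_arr _ _ _ (by decide)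
  have hinv := initWeights_spec hn hpairs (by rw [hpairs7]; exact h7)
  obtain ⟨hinv', hcard⟩ := sweeps_spec hn hs hc hinv
  have harr1 : ((Cmd.loop 1 2 sweep).run n (initWeights.run n (initPairs.run n s))).arr 1 =
      s.arr 1 := by
    rw [Cmd.run_arr _ _ _ (by decide), Cmd.run_arr _ _ _ (by decide), Cmd.run_arr _ _ _ (by decide)]
  obtain ⟨hout, hout'⟩ := output_spec hn hinv' (by rw [harr1]; exact h1)
  obtain ⟨hS1, hS2, hS3⟩ := hinv'.represents.optimal hcard
  refine ⟨hout, _, hS1, hS2, hS3, fun k => (hout' k).trans ?_⟩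
  simp only [Finset.mem_filter, and_assoc]

end

end MatchingProgram

/-! ### Acyclic matchings of `P₄`-free graphs -/

namespace SimpleGraph

variable {V : Type*} {G : SimpleGraph V}

lemma IsP4Free.noP4 (h : G.IsP4Free) : Cograph.NoP4 G.Adj := by
  intro a b c d hab hbc hcd
  by_contra! hcon
  obtain ⟨hac, had, hbd⟩ := hcon
  -- `Cograph.NoP4` does not require distinct vertices, but any coincidence already produces one of
  -- the three adjacencies.
  have h1 : a ≠ c := by rintro rfl; exact had hcd
  have h2 : a ≠ d := by rintro rfl; exact hbd hab.symm
  have h3 : b ≠ d := by rintro rfl; exact had hab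
  refine h ⟨⟨⟨![a, b, c, d], ?_⟩, ?_⟩⟩
  · intro i j hij
    fin_cases i <;> fin_cases j <;>
      simp_all [hab.ne, hbc.ne, hcd.ne, hab.ne', hbc.ne', hcd.ne', h1.symm, h2.symm, h3.symm]
  · intro i j
    change G.Adj (![a, b, c, d] i) (![a, b, c, d] j) ↔ _
    fin_cases i <;> fin_cases j <;>
      simp [pathGraph_adj, hab, hbc, hcd, hac, had, hbd, hab.symm, hbc.symm, hcd.symm,
        G.adj_comm c a, G.adj_comm d a, G.adj_comm d b]

lemma IsAcyclic.not_triangle (h : G.IsAcyclic) {a b c : V} (hab : G.Adj a b) (hbc : G.Adj b c)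
    (hca : G.Adj c a) : False := by
  refine h (Walk.cons hab (Walk.cons hbc (Walk.cons hca Walk.nil))) ?_
  rw [Walk.cons_isCycle_iff]
  simp [Walk.cons_isPath_iff, hab.ne, hab.ne', hbc.ne, hca.ne, hca.ne']

lemma IsAcyclic.not_square (h : G.IsAcyclic) {a b c d : V} (hab : G.Adj a b) (hbc : G.Adj b c)
    (hcd : G.Adj c d) (hda : G.Adj d a) (hac : a ≠ c) (hbd : b ≠ d) : False := by
  refine h (Walk.cons hab (Walk.cons hbc (Walk.cons hcd (Walk.cons hda Walk.nil)))) ?_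
  rw [Walk.cons_isCycle_iff]
  simp [Walk.cons_isPath_iff, hab.ne, hab.ne', hbc.ne, hda.ne, hda.ne', hcd.ne, hac, hac.symm,
    hbd]

/-- Acyclic matchings of `P₄`-free graphs are induced. -/
lemma IsAcyclicMatching.not_adj (hG : G.IsP4Free) {M : Finset (Sym2 V)} (hM : G.IsAcyclicMatching M)
    {a b c d : V} (hab : s(a, b) ∈ M) (hcd : s(c, d) ∈ M) (hne : s(a, b) ≠ s(c, d)) :
    ¬ G.Adj b c := by
  intro hbc
  have hdisj : ∀ v, v ∈ s(a, b) → v ∉ s(c, d) := fun v h1 h2 => hne (hM.1.2 _ hab _ hcd v h1 h2)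
  have hac : a ≠ c := by rintro rfl; exact hdisj a (by simp) (by simp)
  have hbd : b ≠ d := by rintro rfl; exact hdisj b (by simp) (by simp)
  have h1 : G.Adj a b := hM.1.1 _ hab
  have h2 : G.Adj c d := hM.1.1 _ hcd
  let x : coveredVertices M := ⟨a, _, hab, by simp⟩
  let y : coveredVertices M := ⟨b, _, hab, by simp⟩
  let z : coveredVertices M := ⟨c, _, hcd, by simp⟩
  let w : coveredVertices M := ⟨d, _, hcd, by simp⟩
  have hxy : (G.induce (coveredVertices M)).Adj x y := h1
  have hyz : (G.induce (coveredVertices M)).Adj y z := hbc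
  have hzw : (G.induce (coveredVertices M)).Adj z w := h2
  -- The chords `ac` and `bd` give triangles, and `ad` closes a four-cycle; all lie within the
  -- covered vertices.
  rcases hG.noP4 a b c d h1 hbc h2 with h | h | h
  · exact hM.2.not_triangle hxy hyz (show (G.induce (coveredVertices M)).Adj z x from h.symm)
  · exact hM.2.not_square hxy hyz hzw (show (G.induce (coveredVertices M)).Adj w x from h.symm)
      (fun h => hac (congrArg Subtype.val h)) (fun h => hbd (congrArg Subtype.val h))
  · exact hM.2.not_triangle hyz hzw (show (G.induce (coveredVertices M)).Adj w y from h.symm)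

/-- Induced matchings are acyclic. -/
lemma IsEdgeMatching.isAcyclicMatching {M : Finset (Sym2 V)} (hM : G.IsEdgeMatching M)
    (h : ∀ e ∈ M, ∀ f ∈ M, e ≠ f → ∀ x ∈ e, ∀ y ∈ f, ¬ G.Adj x y) : G.IsAcyclicMatching M := by
  refine ⟨hM, fun v c hc => ?_⟩
  obtain ⟨e, he, hv⟩ := v.2
  -- A covered vertex has no covered neighbour except its partner, whereas a vertex on a cycle has
  -- two distinct neighbours.
  have key : ∀ x y : coveredVertices M, (G.induce (coveredVertices M)).Adj v x →
      (G.induce (coveredVertices M)).Adj v y → x = y := by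
    have : ∀ x : coveredVertices M, G.Adj v x → (x : V) ∈ e := by
      intro x hx
      obtain ⟨f, hf, hxf⟩ := x.2
      by_cases hef : e = f
      · rwa [hef]
      · exact absurd hx (h e he f hf hef _ hv _ hxf)
    intro x y hx hy
    have hxe := this x hx
    have hye := this y hy
    have hvx : (v : V) ≠ x := G.ne_of_adj hx
    have hvy : (v : V) ≠ y := G.ne_of_adj hy
    obtain ⟨u, rfl⟩ := hv
    simp only [Sym2.mem_iff] at hxe hye
    exact Subtype.ext ((hxe.resolve_left hvx.symm).trans (hye.resolve_left hvy.symm).symm)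
  exact hc.snd_ne_penultimate (key _ _ (c.adj_snd hc.not_nil) (c.adj_penultimate hc.not_nil).symm)

end SimpleGraph

/-! ### The encoding -/

open RAM MatchingProgram Cograph

lemma matrixWord_getD {n : ℕ} (A : Fin n → Fin n → ℤ) (u v : Fin n) :
    (matrixWord A).getD (u * n + v) 0 = A u v := by
  have hn : 0 < n := u.pos
  have hlt : (u : ℕ) * n + v < n * n := by nlinarith [u.2, v.2]
  have h1 : (⟨u * n + v, hlt⟩ : Fin (n * n)).divNat = u := by
    ext
    simp [Fin.divNat, mul_comm _ n, Nat.mul_add_div hn]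
  have h2 : (⟨u * n + v, hlt⟩ : Fin (n * n)).modNat = v := by
    ext
    simp [Fin.modNat, mul_comm _ n, Nat.mod_eq_of_lt]
  have hlen : (u : ℕ) * n + v < (matrixWord A).length := by simpa [matrixWord] using hlt
  rw [List.getD_eq_getElem _ _ hlen]
  simp only [matrixWord, List.getElem_ofFn]
  rw [h1, h2]

@[simp] lemma matrixWord_length {n : ℕ} (A : Fin n → Fin n → ℤ) :
    (matrixWord A).length = n ^ 2 := by
  simp [matrixWord, sq]

/-- The index of a pair. -/
def pairIndex {n : ℕ} (p : Fin n × Fin n) : ℤ := (p.1 : ℕ) * n + (p.2 : ℕ)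

section

variable {n : ℕ} (p : Fin n × Fin n)

lemma pairIndex_ediv : pairIndex p / n = (p.1 : ℕ) := by
  have := p.2.2
  rw [pairIndex, add_comm, Int.add_mul_ediv_right _ _ (by omega), Int.ediv_eq_zero_of_lt] <;> omega

lemma pairIndex_emod : pairIndex p % n = (p.2 : ℕ) := by
  have := p.2.2
  rw [pairIndex, add_comm, Int.add_mul_emod_self_right, Int.emod_eq_of_lt] <;> omega

lemma pairIndex_injective : Function.Injective (pairIndex (n := n)) := by
  intro p q h
  have h1 := pairIndex_ediv p
  have h2 := pairIndex_emod p
  rw [h, pairIndex_ediv] at h1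
  rw [h, pairIndex_emod] at h2
  ext
  · exact_mod_cast h1.symm
  · exact_mod_cast h2.symm

lemma transpose_pairIndex : transpose n (pairIndex p) = pairIndex p.swap := by
  rw [transpose, pairIndex_ediv, pairIndex_emod, pairIndex]
  rfl

lemma pairIndex_mem : pairIndex p ∈ allPairs n := by
  rw [mem_allPairs, pairIndex]
  have h1 : ((p.1 : ℕ) : ℤ) + 1 ≤ n := by exact_mod_cast p.1.2
  have h2 : ((p.2 : ℕ) : ℤ) + 1 ≤ n := by exact_mod_cast p.2.2
  constructor
  · positivity
  · nlinarith

lemma exists_pairIndex {e : ℤ} (he : e ∈ allPairs n) : ∃ p : Fin n × Fin n, pairIndex p = e := by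
  rw [mem_allPairs] at he
  have hn : (0 : ℤ) < n := by
    rcases Nat.eq_zero_or_pos n with rfl | h
    · simp at he; omega
    · exact_mod_cast h
  have h1 := Int.emod_nonneg e hn.ne'
  have h2 := Int.emod_lt_of_pos e hn
  have h3 := Int.ediv_nonneg he.1 hn.le
  have h4 : e / n < n := Int.ediv_lt_of_lt_mul hn (by nlinarith)
  refine ⟨(⟨(e / n).toNat, by omega⟩, ⟨(e % n).toNat, by omega⟩), ?_⟩
  simp only [pairIndex, Int.toNat_of_nonneg h1, Int.toNat_of_nonneg h3]
  rw [mul_comm]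
  exact Int.mul_ediv_add_emod e n

end

/-! ### The input array, cleared weights, and the conflict relation. -/

namespace EdgeWeightedGraph

variable (I : EdgeWeightedGraph)

/-- The input array. -/
noncomputable def input : ℤ → ℤ := (State.init I.encode).arr 0

lemma input_natCast (k : ℕ) : I.input k = I.encode.getD k 0 := by
  simp [input, State.init]

lemma input_zero : I.input 0 = I.order := by
  simpa [encode] using I.input_natCast 0

lemma input_adj (p : Fin I.order × Fin I.order) [Decidable (I.graph.Adj p.1 p.2)] :
    I.input (1 + pairIndex p) = if I.graph.Adj p.1 p.2 then 1 else 0 := by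
  have h := I.input_natCast (p.1 * I.order + p.2 + 1)
  have hlt : (p.1 : ℕ) * I.order + p.2 < I.order ^ 2 := by nlinarith [p.1.2, p.2.2]
  rw [encode, List.getD_cons_succ, List.getD_append _ _ _ _ (by simpa using by omega),
    List.getD_append _ _ _ _ (by simpa using hlt), matrixWord_getD] at h
  convert h using 2
  rw [pairIndex]; push_cast; ring

lemma input_num (p : Fin I.order × Fin I.order) [Decidable (I.graph.Adj p.1 p.2)] :
    I.input (1 + ((I.order : ℤ) ^ 2 + pairIndex p)) =
      if I.graph.Adj p.1 p.2 then (I.weight s(p.1, p.2)).num else 0 := by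
  have h := I.input_natCast (I.order ^ 2 + (p.1 * I.order + p.2) + 1)
  have hlt : (p.1 : ℕ) * I.order + p.2 < I.order ^ 2 := by nlinarith [p.1.2, p.2.2]
  rw [encode, List.getD_cons_succ, List.getD_append _ _ _ _ (by simpa using by omega),
    List.getD_append_right _ _ _ _ (by simp), matrixWord_length, Nat.add_sub_cancel_left,
    matrixWord_getD] at h
  convert h using 2
  rw [pairIndex]; push_cast; ring

lemma input_den (p : Fin I.order × Fin I.order) [Decidable (I.graph.Adj p.1 p.2)] :
    I.input (1 + ((I.order : ℤ) ^ 2 + (I.order : ℤ) ^ 2 + pairIndex p)) =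
      if I.graph.Adj p.1 p.2 then ((I.weight s(p.1, p.2)).den : ℤ) else 1 := by
  have h := I.input_natCast (I.order ^ 2 + I.order ^ 2 + (p.1 * I.order + p.2) + 1)
  have hlt : (p.1 : ℕ) * I.order + p.2 < I.order ^ 2 := by nlinarith [p.1.2, p.2.2]
  rw [encode, List.getD_cons_succ, List.getD_append_right _ _ _ _ (by simp), List.length_append,
    matrixWord_length, matrixWord_length, Nat.add_sub_cancel_left, matrixWord_getD] at h
  convert h using 2
  rw [pairIndex]; push_cast; ring

/-- The product of all denominators. -/
noncomputable def denominator : ℤ :=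
  ∏ f ∈ Finset.range (I.order ^ 2), I.input (1 + ((I.order : ℤ) ^ 2 + (I.order : ℤ) ^ 2 + f))

lemma denominator_pos : 0 < I.denominator := by
  classical
  refine Finset.prod_pos fun f hf => ?_
  obtain ⟨p, hp⟩ := exists_pairIndex (n := I.order) (e := f)
    (mem_allPairs.2 ⟨by omega, by exact_mod_cast Finset.mem_range.1 hf⟩)
  rw [← hp, input_den]
  split_ifs
  · exact_mod_cast (I.weight _).den_pos
  · exact one_pos

/-- All weights are scaled by the same positive factor, so comparisons of total weights are
preserved. -/
lemma clearedWeight_eq (p : Fin I.order × Fin I.order) [Decidable (I.graph.Adj p.1 p.2)] :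
    (clearedWeight I.input I.order (pairIndex p) : ℚ) =
      (if I.graph.Adj p.1 p.2 then I.weight s(p.1, p.2) else 0) * I.denominator := by
  have hmem := mem_allPairs.1 (pairIndex_mem p)
  obtain ⟨k, hk⟩ := Int.eq_ofNat_of_zero_le hmem.1
  have hk' : k ∈ Finset.range (I.order ^ 2) := by
    rw [Finset.mem_range]
    have := hmem.2
    rw [hk] at this
    exact_mod_cast this
  have hfilter : ((Finset.range (I.order ^ 2)).filter fun f : ℕ => (f : ℤ) ≠ pairIndex p) =
      (Finset.range (I.order ^ 2)).erase k := by
    ext f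
    simp [hk, and_comm]
  rw [clearedWeight, hfilter, denominator, ← Finset.mul_prod_erase _ _ hk', input_num, ← hk,
    input_den]
  split_ifs
  · push_cast
    rw [← mul_assoc, Rat.mul_den_eq_num]
  · simp

lemma conflict_iff (p q : Fin I.order × Fin I.order) :
    Conflict I.input I.order (pairIndex p) (pairIndex q) ↔
      I.graph.Adj p.1 q.1 ∨ I.graph.Adj p.1 q.2 ∨ I.graph.Adj p.2 q.1 ∨ I.graph.Adj p.2 q.2 := by
  classical
  have hadj : ∀ u v : Fin I.order, adjVal I.input I.order (u : ℕ) (v : ℕ) =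
      if I.graph.Adj u v then 1 else 0 := fun u v => I.input_adj (u, v)
  simp only [Conflict, pairIndex_mem, true_and, conflictVal, pairIndex_ediv, pairIndex_emod, hadj]
  split_ifs <;> simp_all

lemma conflict_symm ⦃e f : ℤ⦄ (h : Conflict I.input I.order e f) :
    Conflict I.input I.order f e := by
  obtain ⟨p, rfl⟩ := exists_pairIndex h.1.1
  obtain ⟨q, rfl⟩ := exists_pairIndex h.1.2
  rw [conflict_iff] at h ⊢
  simp only [I.graph.adj_comm q.1, I.graph.adj_comm q.2]
  tauto

lemma pairIndex_mem_positivePairs {p : Fin I.order × Fin I.order} :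
    pairIndex p ∈ positivePairs I.input I.order ↔
      I.graph.Adj p.1 p.2 ∧ 0 < I.weight s(p.1, p.2) := by
  classical
  have h := I.clearedWeight_eq p
  have hd : (0 : ℚ) < I.denominator := by exact_mod_cast I.denominator_pos
  rw [positivePairs, Finset.mem_filter, ← Int.cast_pos (R := ℚ), h, mul_pos_iff_of_pos_right hd]
  simp only [pairIndex_mem, true_and]
  split_ifs with h1 <;> simp [h1]

lemma isCographOn_positivePairs (hI : I.graph.IsP4Free) :
    IsCographOn (Conflict I.input I.order) (positivePairs I.input I.order) := by
  -- Adjacency is transferred to integers, so that quotient and remainder can serve as the entries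
  -- of a pair.
  let r (a b : ℤ) : Prop := ∃ u v : Fin I.order, a = (u : ℕ) ∧ b = (v : ℕ) ∧ I.graph.Adj u v
  have hr : ∀ u v : Fin I.order, r (u : ℕ) (v : ℕ) ↔ I.graph.Adj u v := by
    refine fun u v => ⟨?_, fun h => ⟨u, v, rfl, rfl, h⟩⟩
    rintro ⟨u', v', hu, hv, h⟩
    rwa [Fin.ext (by exact_mod_cast hu : (u : ℕ) = u'),
      Fin.ext (by exact_mod_cast hv : (v : ℕ) = v')]
  have hsymm : ∀ ⦃a b⦄, r a b → r b a := by
    rintro a b ⟨u, v, hu, hv, h⟩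
    exact ⟨v, u, hv, hu, h.symm⟩
  have hP4 : NoP4 r := by
    intro a b c d h1 h2 h3
    obtain ⟨u, v, rfl, rfl, h4⟩ := h1
    obtain ⟨w, x, rfl, rfl, h5⟩ := h3
    rw [hr] at h2
    simpa only [hr] using hI.noP4 _ _ _ _ h4 h2 h5
  have h := IsCographOn.pairs hsymm (fun x ⟨u, v, hu, hv, h⟩ => I.graph.loopless.irrefl u (by
    rwa [← Fin.ext (by exact_mod_cast hu.symm.trans hv : (u : ℕ) = v)] at h))
    (s := fun e => e / I.order) (t := fun e => e % I.order) (A := positivePairs I.input I.order)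
    (fun e he => by
      obtain ⟨p, rfl⟩ := exists_pairIndex (Finset.mem_filter.1 he).1
      simp only [pairIndex_ediv, pairIndex_emod, hr]
      exact (I.pairIndex_mem_positivePairs.1 he).1)
    (hP4.isCographOn hsymm (Finset.Ico 0 (I.order : ℤ)))
  rw [Finset.filter_true_of_mem] at h
  · refine h.congr fun e he f hf => ?_
    obtain ⟨p, rfl⟩ := exists_pairIndex (Finset.mem_filter.1 he).1
    obtain ⟨q, rfl⟩ := exists_pairIndex (Finset.mem_filter.1 hf).1
    simp only [pairIndex_ediv, pairIndex_emod, hr, conflict_iff]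
  · intro e he
    obtain ⟨p, rfl⟩ := exists_pairIndex (Finset.mem_filter.1 he).1
    simp [pairIndex_ediv, pairIndex_emod]

end EdgeWeightedGraph

/-! ### Acyclic matchings as independent sets of pairs. -/

namespace EdgeWeightedGraph

open RAM MatchingProgram Cograph

variable (I : EdgeWeightedGraph)

/-- The set of edges given by a set of pairs. -/
def edgesOf {n : ℕ} (T : Finset (Fin n × Fin n)) : Finset (Sym2 (Fin n)) :=
  T.image fun p => s(p.1, p.2)

/-- The pairs are edges of positive weight, and pairwise not in conflict. -/
structure IsInducedSet (T : Finset (Fin I.order × Fin I.order)) : Prop where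
  adj : ∀ p ∈ T, I.graph.Adj p.1 p.2
  pos : ∀ p ∈ T, 0 < I.weight s(p.1, p.2)
  indep : ∀ p ∈ T, ∀ q ∈ T, p ≠ q → ∀ x ∈ s(p.1, p.2), ∀ y ∈ s(q.1, q.2), ¬ I.graph.Adj x y

variable {I}

lemma isInducedSet_iff {T : Finset (Fin I.order × Fin I.order)} :
    I.IsInducedSet T ↔ T.image pairIndex ⊆ positivePairs I.input I.order ∧
      Indep (Conflict I.input I.order) (T.image pairIndex) := by
  simp only [Indep, Finset.subset_iff, Finset.forall_mem_image, I.pairIndex_mem_positivePairs,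
    conflict_iff, pairIndex_injective.ne_iff]
  constructor
  · intro h
    refine ⟨fun p hp => ⟨h.adj p hp, h.pos p hp⟩, fun p hp q hq hpq => ?_⟩
    simpa [not_or, and_assoc] using h.indep p hp q hq hpq
  · rintro ⟨h1, h2⟩
    refine ⟨fun p hp => (h1 hp).1, fun p hp => (h1 hp).2, fun p hp q hq hpq => ?_⟩
    simpa [not_or, and_assoc] using h2 hp hq hpq

/-- If different pairs shared `x`, the other entry of `p` would be adjacent to the entry `x` of `q`.
Hence non-conflicting pairs form a matching and represent each edge at most once. -/
lemma IsInducedSet.eq_of_mem {T : Finset (Fin I.order × Fin I.order)} (h : I.IsInducedSet T)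
    {p q : Fin I.order × Fin I.order} (hp : p ∈ T) (hq : q ∈ T) {x : Fin I.order}
    (hxp : x ∈ s(p.1, p.2)) (hxq : x ∈ s(q.1, q.2)) : p = q := by
  by_contra hpq
  have hadj := h.adj p hp
  rcases Sym2.mem_iff.1 hxp with rfl | rfl
  · exact h.indep p hp q hq hpq p.2 (by simp) _ hxq hadj.symm
  · exact h.indep p hp q hq hpq p.1 (by simp) _ hxq hadj

lemma IsInducedSet.sum_edgesOf {T : Finset (Fin I.order × Fin I.order)} (h : I.IsInducedSet T) :
    (∑ e ∈ edgesOf T, I.weight e) * I.denominator =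
      ((∑ e ∈ T.image pairIndex, clearedWeight I.input I.order e : ℤ) : ℚ) := by
  classical
  rw [edgesOf, Finset.sum_image, Finset.sum_image pairIndex_injective.injOn, Finset.sum_mul,
    Int.cast_sum]
  · refine Finset.sum_congr rfl fun p hp => ?_
    rw [clearedWeight_eq, if_pos (h.adj p hp)]
  · intro p hp q hq hpq
    exact h.eq_of_mem hp hq (x := p.1) (by simp) (by simp only at hpq; rw [← hpq]; simp)

lemma IsInducedSet.isAcyclicMatching {T : Finset (Fin I.order × Fin I.order)}
    (h : I.IsInducedSet T) : I.graph.IsAcyclicMatching (edgesOf T) := by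
  refine SimpleGraph.IsEdgeMatching.isAcyclicMatching ⟨?_, ?_⟩ ?_ <;>
    simp only [edgesOf, Finset.forall_mem_image]
  · exact fun p hp => h.adj p hp
  · exact fun p hp q hq x hx hy => by rw [h.eq_of_mem hp hq hx hy]
  · exact fun p hp q hq hpq => h.indep p hp q hq fun heq => hpq (by rw [heq])

/-- The ordered representatives of the edges of positive weight in an acyclic matching. -/
lemma exists_isInducedSet (hI : I.graph.IsP4Free) {M : Finset (Sym2 (Fin I.order))}
    (hM : I.graph.IsAcyclicMatching M) :
    ∃ T, I.IsInducedSet T ∧ edgesOf T = M.filter fun e => 0 < I.weight e := by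
  classical
  -- The condition `p.1 < p.2` selects one orientation of each edge, as both orientations would
  -- conflict.
  refine ⟨Finset.univ.filter fun p => p.1 < p.2 ∧ s(p.1, p.2) ∈ M ∧ 0 < I.weight s(p.1, p.2),
    ⟨fun p hp => ?_, fun p hp => ?_, fun p hp q hq hpq x hx y hy => ?_⟩, ?_⟩
  · exact hM.1.1 _ (Finset.mem_filter.1 hp).2.2.1
  · exact (Finset.mem_filter.1 hp).2.2.2
  · simp only [Finset.mem_filter, Finset.mem_univ, true_and] at hp hq
    have hne : s(p.1, p.2) ≠ s(q.1, q.2) := by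
      intro heq
      rcases Sym2.eq_iff.1 heq with ⟨h1, h2⟩ | ⟨h1, h2⟩
      · exact hpq (Prod.ext h1 h2)
      · have := hp.1
        rw [h1, h2] at this
        exact absurd hq.1 this.not_gt
    have hp' := hp.2.1
    have hq' := hq.2.1
    obtain ⟨x', hx'⟩ := hx
    obtain ⟨y', hy'⟩ := hy
    rw [hx', Sym2.eq_swap] at hp' hne
    rw [hy'] at hq' hne
    exact hM.not_adj hI hp' hq' hne
  · ext e
    simp only [edgesOf, Finset.mem_image, Finset.mem_filter, Finset.mem_univ, true_and]
    constructor
    · rintro ⟨p, hp, rfl⟩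
      exact hp.2
    · rintro ⟨he, hw⟩
      induction e using Sym2.ind with
      | _ u v =>
        rcases lt_trichotomy u v with h | rfl | h
        · exact ⟨(u, v), ⟨h, he, hw⟩, rfl⟩
        · exact absurd (hM.1.1 _ he) (I.graph.loopless.irrefl u)
        · exact ⟨(v, u), ⟨h, by rwa [Sym2.eq_swap], by rwa [Sym2.eq_swap]⟩, Sym2.eq_swap⟩

lemma isMaxWeightAcyclicMatching (hI : I.graph.IsP4Free) {S : Finset ℤ}
    (hS : S ⊆ positivePairs I.input I.order) (hind : Indep (Conflict I.input I.order) S)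
    (hopt : ∀ J ⊆ positivePairs I.input I.order, Indep (Conflict I.input I.order) J →
      ∑ e ∈ J, clearedWeight I.input I.order e ≤ ∑ e ∈ S, clearedWeight I.input I.order e)
    {T : Finset (Fin I.order × Fin I.order)} (hT : T.image pairIndex = S) :
    I.graph.IsMaxWeightAcyclicMatching I.weight (edgesOf T) := by
  have hTI : I.IsInducedSet T := isInducedSet_iff.2 ⟨hT ▸ hS, hT ▸ hind⟩
  refine ⟨hTI.isAcyclicMatching, fun M hM => ?_⟩
  obtain ⟨T', hT'I, hT'⟩ := exists_isInducedSet hI hM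
  have h1 : ∑ e ∈ M, I.weight e ≤ ∑ e ∈ edgesOf T', I.weight e := by
    rw [hT', Finset.sum_filter]
    refine Finset.sum_le_sum fun e _ => ?_
    split_ifs with h
    exacts [le_rfl, not_lt.1 h]
  have h2 := isInducedSet_iff.1 hT'I
  have h3 := hopt _ h2.1 h2.2
  rw [← hT, ← Int.cast_le (R := ℚ), ← hTI.sum_edgesOf, ← hT'I.sum_edgesOf] at h3
  exact h1.trans (le_of_mul_le_mul_right h3 (by exact_mod_cast I.denominator_pos))

lemma outputs_edgeSetWord {s : State} {S : Finset ℤ} {T : Finset (Fin I.order × Fin I.order)}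
    (hT : T.image pairIndex = S) (h0 : s.reg 0 = (I.order : ℤ) ^ 2)
    (h1 : ∀ k, s.arr 1 k = if ∃ e ∈ S, k = e ∨ k = transpose I.order e then 1 else 0) :
    s.Outputs (edgeSetWord (edgesOf T)) := by
  classical
  refine ⟨by simp [edgeSetWord, h0], fun k hk => ?_⟩
  rw [edgeSetWord, matrixWord_length] at hk
  obtain ⟨⟨u, v⟩, hp⟩ := exists_pairIndex (n := I.order) (e := k)
    (mem_allPairs.2 ⟨by omega, by exact_mod_cast hk⟩)
  have hk' : k = u * I.order + v := by
    rw [pairIndex] at hp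
    exact_mod_cast hp.symm
  have hval : (edgeSetWord (edgesOf T))[k]'(by rwa [edgeSetWord, matrixWord_length]) =
      if s(u, v) ∈ edgesOf T then 1 else 0 := by
    rw [← List.getD_eq_getElem (d := 0)]
    subst hk'
    exact matrixWord_getD _ u v
  rw [hval, h1, ← hp]
  congr 1
  rw [← hT, eq_iff_iff]
  simp only [edgesOf, Finset.mem_image, exists_exists_and_eq_and, transpose_pairIndex,
    pairIndex_injective.eq_iff]
  -- The transpose accounts for the second orientation of the edge, which makes the output matrix
  -- symmetric.
  refine exists_congr fun p => and_congr_right fun _ => ?_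
  rw [Sym2.eq_iff, Prod.ext_iff, Prod.ext_iff]
  simp only [Prod.fst_swap, Prod.snd_swap]
  tauto

end EdgeWeightedGraph

/-- A maximum weight acyclic matching of a given edge-weighted `P₄`-free graph can be determined in
polynomial time. -/
theorem theorem2 :
    RAM.SolvableInPolyTime (α := EdgeWeightedGraph) (β := fun I => Finset (Sym2 (Fin I.order)))
      (fun I => I.graph.IsP4Free)
      (fun I M => I.graph.IsMaxWeightAcyclicMatching I.weight M)
      EdgeWeightedGraph.encode (fun _ M => edgeSetWord M) := by
  classical
  obtain ⟨T, hT⟩ := RAM.Cmd.runs_init MatchingProgram.main MatchingProgram.main_tame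
    MatchingProgram.zero_notMem_main_stores
  refine ⟨MatchingProgram.main.compile, T, fun I hI => ?_⟩
  -- The number of iterations is polynomial in the value of the order, not in its binary length; the
  -- matrices in the input make the order at most the length of the word.
  have hlen : I.order ≤ I.encode.length := by
    simp only [EdgeWeightedGraph.encode, List.length_cons, List.length_append, matrixWord_length]
    nlinarith
  obtain ⟨t, ht, hrun⟩ := hT I.encode I.order hlen rfl
  obtain ⟨h0, S, hS, hind, hopt, h1⟩ := MatchingProgram.main_spec (n := I.order)
    (s := RAM.State.init I.encode) I.input_zero I.conflict_symm (I.isCographOn_positivePairs hI)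
    (fun k => by simp [RAM.State.init]) (fun k => by simp [RAM.State.init])
  have himage : (Finset.univ.filter fun p : Fin I.order × Fin I.order => pairIndex p ∈ S).image
      pairIndex = S := by
    ext e
    simp only [Finset.mem_image, Finset.mem_filter, Finset.mem_univ, true_and]
    constructor
    · rintro ⟨p, hp, rfl⟩
      exact hp
    · intro he
      obtain ⟨p, rfl⟩ := exists_pairIndex (Finset.mem_filter.1 (hS he)).1
      exact ⟨p, he, rfl⟩
  exact ⟨_, t, hrun, ht, _, EdgeWeightedGraph.isMaxWeightAcyclicMatching hI hS hind hopt himage,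
    EdgeWeightedGraph.outputs_edgeSetWord himage h0 h1⟩
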